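/- Let $G$ be a finite simple graph containing no triangle. A $k$-edge-colouring of $G$ is a map assigning to each edge a colour in $\{1,\dots,k\}$ such that distinct edges sharing an endpoint receive distinct colours; the chromatic index $\chi'(G)$ is the smallest $k$ for which $G$ has a $k$-edge-colouring. A Kempe change of a $k$-edge-colouring consists in choosing two distinct colours $c,d\in\{1,\dots,k\}$ and a connected component of the subgraph of $G$ formed by the edges coloured $c$ or $d$, and exchanging the colours $c$ and $d$ on the edges of this component; the result is again a $k$-edge-colouring. Two $k$-edge-colourings are Kempe-equivalent if one can be reached from the other through a finite series of Kempe changes using only colours from $\{1,\dots,k\}$. Then any two $(\chi'(G)+1)$-edge-colourings of $G$ are Kempe-equivalent. -/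

import Mathlib

namespace SimpleGraph

variable {V : Type*}

/-- A proper `k`-edge-colouring of `G`, with colour set `Fin k`: every edge receives a colour, and
two distinct edges that share an endpoint receive distinct colours. -/
@[ext]
structure EdgeColouring (G : SimpleGraph V) (k : ℕ) where
  /-- the colour of each edge -/
  colour : G.edgeSet → Fin k
  proper : ∀ e f : G.edgeSet, e ≠ f →
    ∀ v : V, v ∈ (e : Sym2 V) → v ∈ (f : Sym2 V) → colour e ≠ colour f

/-- The chromatic index: the smallest `k` such that `G` has a proper `k`-edge-colouring.
(For a finite graph such a `k` exists, see `isLeast_chromaticIndex`.) -/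
noncomputable def chromaticIndex (G : SimpleGraph V) : ℕ :=
  sInf {k : ℕ | Nonempty (G.EdgeColouring k)}

theorem isLeast_chromaticIndex [Finite V] (G : SimpleGraph V) :
    IsLeast {k : ℕ | Nonempty (G.EdgeColouring k)} G.chromaticIndex := by
  have hne : {k : ℕ | Nonempty (G.EdgeColouring k)}.Nonempty :=
    ⟨Nat.card G.edgeSet, ⟨⟨Finite.equivFin G.edgeSet,
      fun e f hef _ _ _ h => hef ((Finite.equivFin G.edgeSet).injective h)⟩⟩⟩
  exact ⟨Nat.sInf_mem hne, fun _ hk => Nat.sInf_le hk⟩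

namespace EdgeColouring

variable {G : SimpleGraph V} {k : ℕ}

/-- The spanning subgraph of `G` whose edges are the edges coloured `c` or `d`. -/
def bicoloured (α : G.EdgeColouring k) (c d : Fin k) : SimpleGraph V where
  Adj u v := ∃ h : G.Adj u v, α.colour ⟨s(u, v), h⟩ = c ∨ α.colour ⟨s(u, v), h⟩ = d
  symm := ⟨by
    rintro u v ⟨h, hc⟩
    refine ⟨h.symm, ?_⟩
    have e : (⟨s(v, u), h.symm⟩ : G.edgeSet) = ⟨s(u, v), h⟩ := Subtype.ext Sym2.eq_swap
    rwa [e]⟩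
  loopless := ⟨fun v hv => G.irrefl hv.1⟩

open Classical in
/-- Exchange the colours `c` and `d` on all edges of `G` that have an endpoint in the connected
component `K` of the subgraph of the edges coloured `c` or `d`. Edges of other colours are
unchanged by the exchange, and an edge coloured `c` or `d` with an endpoint in `K` belongs
to `K`; so this swaps the two colours on exactly the edges of the Kempe chain `K`. -/
noncomputable def kempeSwap (α : G.EdgeColouring k) (c d : Fin k)
    (K : (α.bicoloured c d).ConnectedComponent) : G.EdgeColouring k where
  colour e := if ∃ v ∈ (e : Sym2 V), v ∈ K.supp then Equiv.swap c d (α.colour e) else α.colour e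
  proper := by
    have key : ∀ e : G.edgeSet, ∀ v ∈ (e : Sym2 V), α.colour e = c ∨ α.colour e = d →
        (∃ w ∈ (e : Sym2 V), w ∈ K.supp) → v ∈ K.supp := by
      rintro ⟨e, he⟩ v hv hc ⟨w, hw, hK⟩
      by_cases hvw : v = w
      · exact hvw ▸ hK
      · obtain rfl : e = s(v, w) := (Sym2.mem_and_mem_iff hvw).1 ⟨hv, hw⟩
        have hadj : (α.bicoloured c d).Adj v w := ⟨he, hc⟩
        exact (ConnectedComponent.mem_supp_congr_adj K hadj).2 hK
    have aux : ∀ e f : G.edgeSet, e ≠ f → ∀ v : V, v ∈ (e : Sym2 V) → v ∈ (f : Sym2 V) →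
        (∃ w ∈ (e : Sym2 V), w ∈ K.supp) → ¬ (∃ w ∈ (f : Sym2 V), w ∈ K.supp) →
        Equiv.swap c d (α.colour e) ≠ α.colour f := by
      intro e f hef v hve hvf he hf h
      have hvK : v ∉ K.supp := fun hv => hf ⟨v, hvf, hv⟩
      have h1 : ¬ (α.colour e = c ∨ α.colour e = d) := fun hc => hvK (key e v hve hc he)
      rw [not_or] at h1
      rw [Equiv.swap_apply_of_ne_of_ne h1.1 h1.2] at h
      exact α.proper e f hef v hve hvf h
    intro e f hef v hve hvf
    by_cases he : ∃ w ∈ (e : Sym2 V), w ∈ K.supp <;>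
      by_cases hf : ∃ w ∈ (f : Sym2 V), w ∈ K.supp
    · rw [if_pos he, if_pos hf]
      exact fun h => α.proper e f hef v hve hvf ((Equiv.swap c d).injective h)
    · rw [if_pos he, if_neg hf]
      exact aux e f hef v hve hvf he hf
    · rw [if_neg he, if_pos hf]
      exact (aux f e hef.symm v hvf hve hf he).symm
    · rw [if_neg he, if_neg hf]
      exact α.proper e f hef v hve hvf

/-- `β` is obtained from `α` by one Kempe change: the two colours are swapped on one connected
component of the subgraph of the edges carrying these two colours. (For a component that is a
single vertex nothing changes.) -/
def KempeChange (α β : G.EdgeColouring k) : Prop :=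
  ∃ c d : Fin k, c ≠ d ∧ ∃ K : (α.bicoloured c d).ConnectedComponent, β = α.kempeSwap c d K

/-- `β` can be reached from `α` through a finite series of Kempe changes, all of whose
intermediate colourings are `k`-edge-colourings. -/
def KempeEquivalent (α β : G.EdgeColouring k) : Prop :=
  Relation.ReflTransGen KempeChange α β

end EdgeColouring

end SimpleGraph

/-! Let n be the chromatic index. Make `G` n-regular: on V × {0,1}^(n+1), join the copies of each
vertex of degree d into cubes of dimension n - d. The new graph is triangle-free and independent of
any colouring. Every (n+1)-colouring of `G` extends to it with exactly one colour missing at each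
vertex, and Kempe changes there induce Kempe changes on one copy of `G` (`exists_represents`,
`Represents.kempeEquivalent`).

The common target extends an n-colouring, so every colour but the last is a perfect matching.
`kempeEquiv_of_miss_const` installs these matchings as colour classes one at a time, deleting each
from the graph. To install M as class s, `exists_kempeEquiv_ncard_lt` decreases a count of the
vertices where the class differs from M: it colours an M-edge whose ends both miss s, or recolours
an s-edge outside M, or rotates a fan to create such an M-edge.

The core is `kempeEquiv_of_rotation`: rotating a cyclic fan amounts to Kempe changes. Let the hub p
miss z. If a fan vertex x missing c is not on the z/c-chain of p, swap the chain of x, shift colours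
along the opened fan, and swap back (`exists_rotation_of_not_linked`). Otherwise, after an exchange
away from p, z lies on a cyclic fan around a fan vertex q that avoids the edge pq
(`exists_kempe_next_isPeriodicPt`). As a chain has at most two ends, this second fan can be rotated;
that unlinks p from q, so the first can be rotated too. Without triangles the rotations commute, and
the second is then undone (`kempeEquiv_of_rotation_of_next`). -/

/-- A decomposition of the edges of a graph on `V` into matchings indexed by `C` such that every
vertex is missed by exactly one of the matchings. `nbr c v` is the vertex matched to `v` by the
matching `c`, or `v` itself if `c` misses `v`. -/
structure ColourSystem (V C : Type*) where
  /-- the `c`-neighbour of `v` -/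
  nbr : C → V → V
  /-- the colour missing at `v` -/
  miss : V → C
  nbr_nbr : ∀ c v, nbr c (nbr c v) = v
  nbr_inj : ∀ {v c d}, nbr c v = nbr d v → c = d
  nbr_miss : ∀ v, nbr (miss v) v = v

namespace ColourSystem

variable {V C : Type*}

/-! ### Two-coloured components and their ends. -/

section Basic

variable (S : ColourSystem V C)

theorem nbr_eq_self_iff {c : C} {v : V} : S.nbr c v = v ↔ c = S.miss v :=
  ⟨fun h => S.nbr_inj (h.trans (S.nbr_miss v).symm), fun h => h ▸ S.nbr_miss v⟩

theorem nbr_comm {c : C} {v w : V} : S.nbr c v = w ↔ S.nbr c w = v :=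
  ⟨fun h => h ▸ S.nbr_nbr c v, fun h => h ▸ S.nbr_nbr c w⟩

theorem ext_nbr {S T : ColourSystem V C} (h : ∀ c v, S.nbr c v = T.nbr c v) : S = T := by
  have hm : S.miss = T.miss := by
    funext v
    rw [← T.nbr_eq_self_iff, ← h, S.nbr_miss]
  have hn : S.nbr = T.nbr := by
    funext c v
    exact h c v
  cases S
  cases T
  simp only at hm hn
  subst hm hn
  rfl

/-- A vertex is fixed by a matching exactly when no edge of the matching meets it, so loops need no
comparison. -/
theorem ext_edges {S T : ColourSystem V C}
    (h : ∀ c v w, v ≠ w → (S.nbr c v = w ↔ T.nbr c v = w)) : S = T := by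
  refine ext_nbr fun c v => ?_
  by_cases hS : S.nbr c v = v
  · by_contra hne
    have hT : v ≠ T.nbr c v := fun e => hne (hS.trans e)
    exact hT (hS.symm.trans ((h c v _ hT).2 rfl))
  · exact ((h c v _ (Ne.symm hS)).1 rfl).symm

/-- `K` is a union of components of the graph of the edges coloured `a` or `b`. -/
def Closed (a b : C) (K : Set V) : Prop := ∀ v ∈ K, S.nbr a v ∈ K ∧ S.nbr b v ∈ K

variable {S}

theorem Closed.symm {a b : C} {K : Set V} (h : S.Closed a b K) : S.Closed b a K :=
  fun v hv => (h v hv).symm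

theorem Closed.compl {a b : C} {K : Set V} (h : S.Closed a b K) : S.Closed a b Kᶜ :=
  fun v hv => ⟨fun h' => hv (S.nbr_nbr a v ▸ (h _ h').1), fun h' => hv (S.nbr_nbr b v ▸ (h _ h').2)⟩

theorem Closed.nbr_swap_mem {a b c : C} {K : Set V} (h : S.Closed a b K) {v : V}
    (hv : v ∈ K) (hc : c = a ∨ c = b) : S.nbr c v ∈ K := by
  rcases hc with rfl | rfl
  exacts [(h v hv).1, (h v hv).2]

variable (S)

/-- `x` and `y` lie in the same component of the graph of the edges coloured `a` or `b`. -/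
def Linked (a b : C) (x y : V) : Prop := ∀ K, S.Closed a b K → x ∈ K → y ∈ K

variable {S}

theorem Linked.symm {a b : C} {x y : V} (h : S.Linked a b x y) : S.Linked a b y x :=
  fun K hK hy => by
    by_contra hx
    exact h _ hK.compl hx hy

theorem Linked.swap {a b : C} {x y : V} (h : S.Linked a b x y) : S.Linked b a x y :=
  fun K hK => h K hK.symm

/-- The two matchings are involutions A and B with A fixing x, so the component of x is its orbit
under h = AB. The point h^i x is an end exactly when the period n (0 for an infinite orbit) divides
2i or 2i + 1. Modulo n, this leaves at most one end besides x. -/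
theorem not_linked_of_nbr {a b : C} {x y z : V} (hx : S.nbr a x = x)
    (hy : S.nbr a y = y ∨ S.nbr b y = y) (hz : S.nbr a z = z ∨ S.nbr b z = z)
    (hxy : x ≠ y) (hxz : x ≠ z) (hyz : y ≠ z) : ¬ (S.Linked a b x y ∧ S.Linked a b x z) := by
  rintro ⟨h1, h2⟩
  let A : Equiv.Perm V := Function.Involutive.toPerm (S.nbr a) (S.nbr_nbr a)
  let B : Equiv.Perm V := Function.Involutive.toPerm (S.nbr b) (S.nbr_nbr b)
  have hA : ∀ v, A v = S.nbr a v := fun _ => rfl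
  have hB : ∀ v, B v = S.nbr b v := fun _ => rfl
  have hAA : A * A = 1 := by
    ext v
    simp [hA, S.nbr_nbr]
  have hBB : B * B = 1 := by
    ext v
    simp [hB, S.nbr_nbr]
  have hAi : A⁻¹ = A := inv_eq_of_mul_eq_one_left hAA
  have hBi : B⁻¹ = B := inv_eq_of_mul_eq_one_left hBB
  set h : Equiv.Perm V := A * B with hh
  have hconj : ∀ i : ℤ, A * h ^ i = h ^ (-i) * A := by
    intro i
    have h1 : A * h * A⁻¹ = h⁻¹ := by
      rw [hh, mul_inv_rev, hAi, hBi, ← mul_assoc, hAA, one_mul]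
    have h2 : A * h ^ i * A⁻¹ = h ^ (-i) := by
      rw [← conj_zpow, h1, inv_zpow, zpow_neg]
    rw [← h2, inv_mul_cancel_right]
  have hAx : ∀ i : ℤ, S.nbr a ((h ^ i) x) = (h ^ (-i)) x := by
    intro i
    have := congrArg (fun p : Equiv.Perm V => p x) (hconj i)
    simpa [hA, hx] using this
  have hBx : ∀ i : ℤ, S.nbr b ((h ^ i) x) = (h ^ (-(i + 1))) x := by
    intro i
    have hBh : B = A * h := by rw [hh, ← mul_assoc, hAA, one_mul]
    rw [← hAx, ← hB, hBh, Equiv.Perm.mul_apply, add_comm i 1, zpow_add, zpow_one,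
      Equiv.Perm.mul_apply, hA]
    rfl
  have hcl : S.Closed a b {v | ∃ i : ℤ, (h ^ i) x = v} := by
    rintro _ ⟨i, rfl⟩
    exact ⟨⟨_, (hAx i).symm⟩, ⟨_, (hBx i).symm⟩⟩
  obtain ⟨i, rfl⟩ := h1 _ hcl ⟨0, rfl⟩
  obtain ⟨j, rfl⟩ := h2 _ hcl ⟨0, rfl⟩
  set n : ℤ := (MulAction.period h x : ℤ) with hn
  have hper : ∀ k : ℤ, (h ^ k) x = x ↔ n ∣ k := fun k =>
    MulAction.zpow_smul_eq_iff_period_dvd (g := h) (a := x)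
  have hsub : ∀ k l : ℤ, (h ^ k) x = (h ^ l) x ↔ n ∣ l - k := by
    intro k l
    rw [← hper, sub_eq_add_neg, add_comm, zpow_add, Equiv.Perm.mul_apply, zpow_neg,
      Equiv.Perm.inv_eq_iff_eq, eq_comm]
  have e1 : ¬ n ∣ i := fun e => hxy ((hper i).2 e).symm
  have e2 : ¬ n ∣ j := fun e => hxz ((hper j).2 e).symm
  have e3 : ¬ n ∣ j - i := fun e => hyz ((hsub i j).2 e)
  have key : ∀ k : ℤ, S.nbr a ((h ^ k) x) = (h ^ k) x ∨ S.nbr b ((h ^ k) x) = (h ^ k) x →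
      n ∣ 2 * k ∨ n ∣ 2 * k + 1 := by
    intro k hk
    rw [hAx, hBx, hsub, hsub] at hk
    rcases hk with hk | hk
    · exact Or.inl (by rwa [sub_neg_eq_add, ← two_mul] at hk)
    · exact Or.inr (by rwa [sub_neg_eq_add, ← add_assoc, ← two_mul] at hk)
  -- Such a k is half an odd multiple of n: two of them differ by a multiple of n, and one of them
  -- forces n to be even, excluding n ∣ 2l + 1.
  have half : ∀ k : ℤ, ¬ n ∣ k → n ∣ 2 * k → ∃ t, 2 * k = n * (2 * t + 1) := by
    rintro k hk ⟨s, hs⟩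
    rcases Int.even_or_odd' s with ⟨t, rfl | rfl⟩
    · exact absurd ⟨t, by linarith⟩ hk
    · exact ⟨t, hs⟩
  have mixed : ∀ k l : ℤ, ¬ n ∣ k → n ∣ 2 * k → n ∣ 2 * l + 1 → False := by
    intro k l hk h2k h2l
    obtain ⟨t, ht⟩ := half k hk h2k
    have hev : Even n := by
      have : Even (n * (2 * t + 1)) := ht ▸ even_two_mul k
      rcases Int.even_mul.1 this with h | h
      · exact h
      · exact absurd h (Int.not_even_iff_odd.2 ⟨t, rfl⟩)
    have := (even_iff_two_dvd.1 hev).trans h2l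
    omega
  rcases key i hy with hi | hi <;> rcases key j hz with hj | hj
  · obtain ⟨t, ht⟩ := half i e1 hi
    obtain ⟨s, hs⟩ := half j e2 hj
    exact e3 ⟨s - t, by linarith⟩
  · exact mixed _ _ e1 hi hj
  · exact mixed _ _ e2 hj hi
  · have hd : n ∣ 2 * (j - i) := by
      have := dvd_sub hj hi
      rwa [add_sub_add_right_eq_sub, ← mul_sub] at this
    exact mixed _ _ e3 hd hi

/-- A component of the graph of the edges of two colours has at most two ends. -/
theorem not_linked_of_miss {a b : C} {x y z : V} (hx : S.miss x = a ∨ S.miss x = b)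
    (hy : S.miss y = a ∨ S.miss y = b) (hz : S.miss z = a ∨ S.miss z = b)
    (hxy : x ≠ y) (hxz : x ≠ z) (hyz : y ≠ z) (h1 : S.Linked a b x y) : ¬ S.Linked a b x z := by
  intro h2
  have conv : ∀ {v : V}, S.miss v = a ∨ S.miss v = b → S.nbr a v = v ∨ S.nbr b v = v := by
    intro v hv
    rw [S.nbr_eq_self_iff, S.nbr_eq_self_iff]
    exact hv.imp Eq.symm Eq.symm
  rcases conv hx with h | h
  · exact not_linked_of_nbr h (conv hy) (conv hz) hxy hxz hyz ⟨h1, h2⟩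
  · exact not_linked_of_nbr h (conv hy).symm (conv hz).symm hxy hxz hyz ⟨h1.swap, h2.swap⟩

theorem exists_closed_of_not_linked {a b : C} {x y : V} (h : ¬ S.Linked a b x y) :
    ∃ K, S.Closed a b K ∧ x ∈ K ∧ y ∉ K := by
  simpa [Linked] using h

end Basic

/-! ### Kempe exchanges on colour systems. -/

section Kempe

variable [DecidableEq C]

open Classical in
/-- Exchange the colours `a` and `b` on the edges meeting `K`. -/
noncomputable def kempe (S : ColourSystem V C) (a b : C) (K : Set V) (hK : S.Closed a b K) :
    ColourSystem V C where
  nbr c v := if v ∈ K then S.nbr (Equiv.swap a b c) v else S.nbr c v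
  miss v := if v ∈ K then Equiv.swap a b (S.miss v) else S.miss v
  nbr_nbr c v := by
    by_cases hab : c = a ∨ c = b
    · have hs : Equiv.swap a b c = a ∨ Equiv.swap a b c = b := by
        rcases hab with rfl | rfl <;> simp
      by_cases hv : v ∈ K
      · rw [if_pos hv, if_pos (hK.nbr_swap_mem hv hs), S.nbr_nbr]
      · rw [if_neg hv, if_neg (hK.compl.nbr_swap_mem hv hab), S.nbr_nbr]
    · rw [not_or] at hab
      simp only [Equiv.swap_apply_of_ne_of_ne hab.1 hab.2, ite_self, S.nbr_nbr]
  nbr_inj := by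
    intro v c d h
    by_cases hv : v ∈ K
    · simp only [if_pos hv] at h
      exact (Equiv.swap a b).injective (S.nbr_inj h)
    · simp only [if_neg hv] at h
      exact S.nbr_inj h
  nbr_miss v := by
    by_cases hv : v ∈ K
    · simp only [if_pos hv, Equiv.swap_apply_self, S.nbr_miss]
    · simp only [if_neg hv, S.nbr_miss]

variable {S S' S'' : ColourSystem V C} {a b : C} {K : Set V}

theorem kempe_nbr_mem (hK : S.Closed a b K) {v : V} (hv : v ∈ K) (c : C) :
    (S.kempe a b K hK).nbr c v = S.nbr (Equiv.swap a b c) v := if_pos hv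

theorem kempe_nbr_not_mem (hK : S.Closed a b K) {v : V} (hv : v ∉ K) (c : C) :
    (S.kempe a b K hK).nbr c v = S.nbr c v := if_neg hv

theorem kempe_nbr_of_ne (hK : S.Closed a b K) {c : C} (ha : c ≠ a) (hb : c ≠ b) (v : V) :
    (S.kempe a b K hK).nbr c v = S.nbr c v := by
  by_cases hv : v ∈ K
  · rw [kempe_nbr_mem hK hv, Equiv.swap_apply_of_ne_of_ne ha hb]
  · rw [kempe_nbr_not_mem hK hv]

theorem kempe_miss_mem (hK : S.Closed a b K) {v : V} (hv : v ∈ K) :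
    (S.kempe a b K hK).miss v = Equiv.swap a b (S.miss v) := if_pos hv

theorem kempe_miss_not_mem (hK : S.Closed a b K) {v : V} (hv : v ∉ K) :
    (S.kempe a b K hK).miss v = S.miss v := if_neg hv

theorem kempe_miss_of_ne (hK : S.Closed a b K) {v : V} (ha : S.miss v ≠ a) (hb : S.miss v ≠ b) :
    (S.kempe a b K hK).miss v = S.miss v := by
  by_cases hv : v ∈ K
  · rw [kempe_miss_mem hK hv, Equiv.swap_apply_of_ne_of_ne ha hb]
  · rw [kempe_miss_not_mem hK hv]

/-- `S'` arises from `S` by exchanging two colours on some of the components of the graph of the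
edges of these two colours. -/
def Step (S S' : ColourSystem V C) : Prop :=
  ∃ (a b : C) (K : Set V) (hK : S.Closed a b K), S' = S.kempe a b K hK

theorem Step.symm (h : Step S S') : Step S' S := by
  obtain ⟨a, b, K, hK, rfl⟩ := h
  have hK' : (S.kempe a b K hK).Closed a b K := by
    intro v hv
    rw [kempe_nbr_mem hK hv, kempe_nbr_mem hK hv, Equiv.swap_apply_left, Equiv.swap_apply_right]
    exact (hK v hv).symm
  refine ⟨a, b, K, hK', ext_nbr fun c v => ?_⟩
  · by_cases hv : v ∈ K
    · rw [kempe_nbr_mem _ hv, kempe_nbr_mem _ hv, Equiv.swap_apply_self]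
    · rw [kempe_nbr_not_mem hK' hv, kempe_nbr_not_mem hK hv]

/-- Equivalence of colour systems under Kempe changes. -/
def KempeEquiv (S S' : ColourSystem V C) : Prop := Relation.ReflTransGen Step S S'

theorem KempeEquiv.refl (S : ColourSystem V C) : KempeEquiv S S := Relation.ReflTransGen.refl

theorem KempeEquiv.symm (h : KempeEquiv S S') : KempeEquiv S' S := by
  induction h with
  | refl => exact Relation.ReflTransGen.refl
  | tail _ hs ih => exact Relation.ReflTransGen.head hs.symm ih

theorem KempeEquiv.trans (h : KempeEquiv S S') (h' : KempeEquiv S' S'') : KempeEquiv S S'' :=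
  Relation.ReflTransGen.trans h h'

theorem kempeEquiv_kempe (hK : S.Closed a b K) : KempeEquiv S (S.kempe a b K hK) :=
  Relation.ReflTransGen.single ⟨a, b, K, hK, rfl⟩

end Kempe

end ColourSystem

/-! ### Fans and rotations about a vertex. -/

namespace ColourSystem

variable {V C : Type*}

theorem perm_apply_inv (π : Equiv.Perm C) (c : C) : π (π⁻¹ c) = c := Equiv.apply_symm_apply π c

theorem perm_inv_apply (π : Equiv.Perm C) (c : C) : π⁻¹ (π c) = c := Equiv.symm_apply_apply π c

/-- `S'` arises from `S` by recolouring the edges at `p` according to the permutation `π` of the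
colours. -/
structure Rotation (S S' : ColourSystem V C) (p : V) (π : Equiv.Perm C) : Prop where
  hub : ∀ c, S'.nbr (π c) p = S.nbr c p
  away : ∀ c v w, v ≠ p → w ≠ p → v ≠ w → (S.nbr c v = w ↔ S'.nbr c v = w)

namespace Rotation

variable {S S' S'' : ColourSystem V C} {p : V} {π ρ : Equiv.Perm C}

theorem hub_inv (h : Rotation S S' p π) (c : C) : S'.nbr c p = S.nbr (π⁻¹ c) p := by
  rw [← h.hub, perm_apply_inv]

theorem symm (h : Rotation S S' p π) : Rotation S' S p π⁻¹ where
  hub c := (h.hub_inv c).symm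
  away c v w hv hw hvw := (h.away c v w hv hw hvw).symm

theorem trans (h : Rotation S S' p π) (h' : Rotation S' S'' p ρ) :
    Rotation S S'' p (ρ * π) where
  hub c := by rw [Equiv.Perm.mul_apply, h'.hub, h.hub]
  away c v w hv hw hvw := (h.away c v w hv hw hvw).trans (h'.away c v w hv hw hvw)

theorem unique (h : Rotation S S' p π) (h' : Rotation S S'' p π) : S' = S'' := by
  have hp : ∀ c, S'.nbr c p = S''.nbr c p := fun c => by rw [h.hub_inv, h'.hub_inv]
  refine ext_edges fun c v w hvw => ?_
  by_cases hv : v = p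
  · subst hv
    rw [hp]
  by_cases hw : w = p
  · subst hw
    rw [S'.nbr_comm, S''.nbr_comm, hp]
  rw [← h.away c v w hv hw hvw, h'.away c v w hv hw hvw]

theorem nbr_eq (h : Rotation S S' p π) {c : C} {v : V} (hv : v ≠ p) (h1 : S.nbr c v ≠ p)
    (h2 : S'.nbr c v ≠ p) : S'.nbr c v = S.nbr c v := by
  by_cases hS : v = S.nbr c v
  · by_contra hne
    have : v ≠ S'.nbr c v := fun e => hne (e.symm.trans hS)
    exact hne ((h.away c v _ hv h2 this).2 rfl).symm
  · exact (h.away c v _ hv h1 hS).1 rfl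

theorem miss_hub (h : Rotation S S' p π) : S'.miss p = π (S.miss p) := by
  rw [eq_comm, ← S'.nbr_eq_self_iff, h.hub, S.nbr_miss]

theorem miss_nbr (h : Rotation S S' p π) {c : C} (hp : S.nbr c p ≠ p) (hc : π c ≠ c) :
    S'.miss (S.nbr c p) = c := by
  rw [eq_comm, ← S'.nbr_eq_self_iff]
  by_contra hne
  by_cases h1 : S'.nbr c (S.nbr c p) = p
  · rw [S'.nbr_comm, ← h.hub] at h1
    exact hc (S'.nbr_inj h1).symm
  · have := (h.away c _ _ hp h1 (Ne.symm hne)).2 rfl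
    rw [S.nbr_nbr] at this
    exact h1 this.symm

theorem miss_eq (h : Rotation S S' p π) {v : V} (hv : v ≠ p)
    (hf : ∀ c, S.nbr c p = v → π c = c) : S'.miss v = S.miss v := by
  rw [eq_comm, ← S'.nbr_eq_self_iff]
  by_contra hne
  by_cases h1 : S'.nbr (S.miss v) v = p
  · rw [S'.nbr_comm, h.hub_inv] at h1
    have h2 := hf _ h1
    rw [perm_apply_inv] at h2
    rw [← h2, S.nbr_comm, S.nbr_miss] at h1
    exact hv h1
  · have := (h.away _ _ _ hv h1 (Ne.symm hne)).2 rfl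
    rw [S.nbr_miss] at this
    exact hne this.symm

end Rotation

/-- Every colour moved by `π` is moved to the colour missing at the corresponding neighbour
of `p`. -/
def IsFan (S : ColourSystem V C) (p : V) (π : Equiv.Perm C) : Prop :=
  ∀ c, π c ≠ c → π c = S.miss (S.nbr c p)

namespace IsFan

variable {S S' : ColourSystem V C} {p : V} {π : Equiv.Perm C}

theorem apply_miss (h : S.IsFan p π) : π (S.miss p) = S.miss p := by
  by_contra hne
  have := h _ hne
  rw [S.nbr_miss] at this
  exact hne this

theorem nbr_ne (h : S.IsFan p π) {c : C} (hc : π c ≠ c) : S.nbr c p ≠ p := by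
  intro e
  rw [S.nbr_eq_self_iff] at e
  exact hc (e ▸ h.apply_miss)

theorem rotation (h : S.IsFan p π) (hr : Rotation S S' p π) : S'.IsFan p π⁻¹ := by
  intro c hc
  have h1 : π (π⁻¹ c) ≠ π⁻¹ c := by
    rw [perm_apply_inv]
    exact hc.symm
  rw [hr.hub_inv, hr.miss_nbr (h.nbr_ne h1) h1]

/-- Each spoke keeps its colour or receives the one missing at its outer end, so no conflict arises.
-/
theorem exists_rotation (h : S.IsFan p π) : ∃ S', Rotation S S' p π := by
  classical
  have hmoved : ∀ {c v}, v ≠ p → S.nbr (π⁻¹ c) p = v → S.nbr c v ≠ p → c = S.miss v := by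
    intro c v hv h1 h2
    have hne : π (π⁻¹ c) ≠ π⁻¹ c := by
      rw [perm_apply_inv]
      intro e
      rw [← e, S.nbr_comm] at h1
      exact h2 h1
    have := h _ hne
    rwa [perm_apply_inv, h1] at this
  -- Away from the hub: the end of the new c-spoke is matched to the hub, the end of a c-spoke that
  -- lost its colour becomes unmatched, and all else stays.
  let N : C → V → V := fun c v =>
    if v = p then S.nbr (π⁻¹ c) p else if S.nbr (π⁻¹ c) p = v then p
      else if S.nbr c v = p then v else S.nbr c v
  have N1 : ∀ c, N c p = S.nbr (π⁻¹ c) p := fun c => if_pos rfl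
  have N2 : ∀ {c v}, v ≠ p → S.nbr (π⁻¹ c) p = v → N c v = p := fun hv h1 =>
    (if_neg hv).trans (if_pos h1)
  have N3 : ∀ {c v}, v ≠ p → S.nbr (π⁻¹ c) p ≠ v → S.nbr c v = p → N c v = v := fun hv h1 h2 =>
    (if_neg hv).trans ((if_neg h1).trans (if_pos h2))
  have N4 : ∀ {c v}, v ≠ p → S.nbr (π⁻¹ c) p ≠ v → S.nbr c v ≠ p → N c v = S.nbr c v :=
    fun hv h1 h2 => (if_neg hv).trans ((if_neg h1).trans (if_neg h2))
  have hinv : ∀ c v, N c (N c v) = v := by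
    intro c v
    by_cases hv : v = p
    · subst hv
      by_cases h1 : S.nbr (π⁻¹ c) v = v
      · rw [N1, h1, N1, h1]
      · rw [N1, N2 h1 rfl]
    by_cases h1 : S.nbr (π⁻¹ c) p = v
    · rw [N2 hv h1, N1, h1]
    by_cases h2 : S.nbr c v = p
    · rw [N3 hv h1 h2, N3 hv h1 h2]
    rw [N4 hv h1 h2, N4 h2, S.nbr_nbr]
    · intro h3
      have := hmoved h2 h3 (by rwa [S.nbr_nbr])
      rw [← S.nbr_eq_self_iff, S.nbr_nbr] at this
      exact h1 (h3.trans this.symm)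
    · rwa [S.nbr_nbr]
  have hinj : ∀ {v c d}, N c v = N d v → c = d := by
    intro v c d hcd
    by_cases hv : v = p
    · subst hv
      rw [N1, N1] at hcd
      exact π⁻¹.injective (S.nbr_inj hcd)
    have main : ∀ {c d}, N c v = N d v → S.nbr (π⁻¹ c) p = v → c = d := by
      intro c d hcd h1
      by_cases g1 : S.nbr (π⁻¹ d) p = v
      · exact π⁻¹.injective (S.nbr_inj (h1.trans g1.symm))
      rw [N2 hv h1] at hcd
      by_cases g2 : S.nbr d v = p
      · rw [N3 hv g1 g2] at hcd
        exact absurd hcd.symm hv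
      · rw [N4 hv g1 g2] at hcd
        exact absurd hcd.symm g2
    have aux : ∀ {c d}, N c v = N d v → S.nbr (π⁻¹ c) p ≠ v → S.nbr (π⁻¹ d) p ≠ v →
        S.nbr c v = p → c = d := by
      intro c d hcd h1 g1 h2
      rw [N3 hv h1 h2] at hcd
      by_cases g2 : S.nbr d v = p
      · exact S.nbr_inj (h2.trans g2.symm)
      rw [N4 hv g1 g2] at hcd
      have hd := S.nbr_eq_self_iff.1 hcd.symm
      have hc : π c ≠ c := by
        intro e
        rw [Equiv.Perm.inv_eq_iff_eq.2 e.symm] at h1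
        exact h1 (S.nbr_comm.1 h2)
      have h3 := h c hc
      rw [S.nbr_comm.1 h2, ← hd] at h3
      rw [← h3, perm_inv_apply] at g1
      exact absurd (S.nbr_comm.1 h2) g1
    by_cases h1 : S.nbr (π⁻¹ c) p = v
    · exact main hcd h1
    by_cases g1 : S.nbr (π⁻¹ d) p = v
    · exact (main hcd.symm g1).symm
    by_cases h2 : S.nbr c v = p
    · exact aux hcd h1 g1 h2
    by_cases g2 : S.nbr d v = p
    · exact (aux hcd.symm g1 h1 g2).symm
    rw [N4 hv h1 h2, N4 hv g1 g2] at hcd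
    exact S.nbr_inj hcd
  have hmiss : ∀ v, ∃ c, N c v = v := by
    intro v
    by_cases hv : v = p
    · subst hv
      exact ⟨π (S.miss v), by rw [N1, perm_inv_apply, S.nbr_miss]⟩
    by_cases hsp : ∃ c, S.nbr c p = v ∧ π c ≠ c
    · obtain ⟨c, rfl, hc⟩ := hsp
      refine ⟨c, N3 hv ?_ (S.nbr_nbr c p)⟩
      intro e
      exact hc (Equiv.Perm.inv_eq_iff_eq.1 (S.nbr_inj e)).symm
    · push Not at hsp
      have hm : S.nbr (S.miss v) v ≠ p := by rwa [S.nbr_miss]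
      refine ⟨S.miss v, ?_⟩
      rw [N4 hv ?_ hm, S.nbr_miss]
      intro e
      have e2 := hsp _ e
      rw [perm_apply_inv] at e2
      rw [← e2, S.nbr_comm] at e
      exact hm e
  choose m hm using hmiss
  refine ⟨⟨N, m, hinv, hinj, hm⟩, ⟨fun c => ?_, fun c v w hv hw hvw => ?_⟩⟩
  · change N (π c) p = _
    rw [N1, perm_inv_apply]
  · change _ ↔ N c v = w
    by_cases h1 : S.nbr (π⁻¹ c) p = v
    · rw [N2 hv h1]
      refine ⟨fun e => ?_, fun e => absurd e.symm hw⟩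
      by_cases h2 : S.nbr c v = p
      · exact absurd (e.symm.trans h2) hw
      · have := hmoved hv h1 h2
        rw [← S.nbr_eq_self_iff] at this
        exact absurd (this.symm.trans e) hvw
    by_cases h2 : S.nbr c v = p
    · rw [N3 hv h1 h2, h2]
      exact ⟨fun e => absurd e.symm hw, fun e => absurd e hvw⟩
    · rw [N4 hv h1 h2]

end IsFan

section

variable [DecidableEq C] {S : ColourSystem V C} {p : V}

/-- The b-edge at p is a whole component of the two colours, both its ends missing the other one. -/
theorem exists_rotation_swap {b : C} (hx : S.nbr b p ≠ p) (hm : S.miss (S.nbr b p) = S.miss p) :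
    ∃ S', KempeEquiv S S' ∧ Rotation S S' p (Equiv.swap (S.miss p) b) := by
  have hK : S.Closed (S.miss p) b {p, S.nbr b p} := by
    rintro v (rfl | rfl)
    · simp [S.nbr_miss]
    · simp [S.nbr_nbr, S.nbr_eq_self_iff.2 hm.symm]
  refine ⟨_, kempeEquiv_kempe hK, fun c => ?_, fun c v w hv hw hvw => ?_⟩
  · rw [kempe_nbr_mem hK (Or.inl rfl), Equiv.swap_apply_self]
  · by_cases hvK : v ∈ ({p, S.nbr b p} : Set V)
    · obtain rfl : v = S.nbr b p := hvK.resolve_left hv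
      rw [kempe_nbr_mem hK hvK]
      by_cases h1 : c = S.miss p
      · rw [h1, Equiv.swap_apply_left, S.nbr_nbr, S.nbr_eq_self_iff.2 hm.symm]
        exact ⟨fun e => absurd e hvw, fun e => absurd e.symm hw⟩
      by_cases h2 : c = b
      · rw [h2, Equiv.swap_apply_right, S.nbr_nbr, S.nbr_eq_self_iff.2 hm.symm]
        exact ⟨fun e => absurd e.symm hw, fun e => absurd e hvw⟩
      rw [Equiv.swap_apply_of_ne_of_ne h1 h2]
    · rw [kempe_nbr_not_mem hK hvK]

/-- Recolouring along a fan that ends in a neighbour missing the colour that `p` misses. -/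
theorem exists_rotation_path (n : ℕ) : ∀ (S : ColourSystem V C) (y : ℕ → C),
    (∀ i < n, S.miss (S.nbr (y i) p) = y (i + 1)) → S.miss p = y n →
    (∀ i ≤ n, ∀ j ≤ n, y i = y j → i = j) →
    ∃ S' π, KempeEquiv S S' ∧ Rotation S S' p π ∧ (∀ i < n, π (y i) = y (i + 1)) ∧
      π (y n) = y 0 ∧ ∀ c, (∀ i ≤ n, y i ≠ c) → π c = c := by
  induction n with
  | zero =>
    intro S y _ _ _
    exact ⟨S, 1, KempeEquiv.refl S, ⟨fun _ => rfl, fun _ _ _ _ _ _ => Iff.rfl⟩, by simp, by simp⟩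
  | succ n ih =>
    intro S y hstep hend hinj
    have hne : ∀ i ≤ n, y i ≠ S.miss p := by
      intro i hi e
      have := hinj i (by omega) (n + 1) le_rfl (e.trans hend)
      omega
    have hnbr : ∀ i ≤ n, S.nbr (y i) p ≠ p := fun i hi e => hne i hi (S.nbr_eq_self_iff.1 e)
    -- Recolouring the last spoke makes the hub miss `y n`, the colour in which the fan shortened by
    -- one spoke ends.
    obtain ⟨S1, hS1, hr1⟩ := exists_rotation_swap (b := y n) (hnbr n le_rfl)
      ((hstep n (by omega)).trans hend.symm)
    have hfix : ∀ i < n, Equiv.swap (S.miss p) (y n) (y i) = y i := fun i hi =>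
      Equiv.swap_apply_of_ne_of_ne (hne i hi.le) fun e => by
        have := hinj i (by omega) n (by omega) e
        omega
    have h1 : S1.miss p = y n := by rw [hr1.miss_hub, Equiv.swap_apply_left]
    obtain ⟨S2, π, hS2, hr2, hπ, hlast, hfixπ⟩ := ih S1 y (fun i hi => by
        have e1 : S1.nbr (y i) p = S.nbr (y i) p := by
          have := hr1.hub (y i)
          rwa [hfix i hi] at this
        rw [e1, hr1.miss_eq (hnbr i hi.le), hstep i (by omega)]
        intro c hc
        rw [S.nbr_inj hc, hfix i hi]) h1
      (fun i hi j hj => hinj i (by omega) j (by omega))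
    refine ⟨S2, _, hS1.trans hS2, hr1.trans hr2, fun i hi => ?_, ?_, fun c hc => ?_⟩
    · rw [Equiv.Perm.mul_apply]
      rcases Nat.lt_succ_iff_lt_or_eq.1 hi with hi | rfl
      · rw [hfix i hi, hπ i hi]
      · rw [Equiv.swap_apply_right, hend]
        exact hfixπ _ fun j hj e => by
          have := hinj j (by omega) (i + 1) le_rfl e
          omega
    · rw [Equiv.Perm.mul_apply, ← hend, Equiv.swap_apply_left, hlast]
    · rw [Equiv.Perm.mul_apply, Equiv.swap_apply_of_ne_of_ne, hfixπ]
      · exact fun i hi => hc i (by omega)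
      · rw [hend]
        exact (hc _ le_rfl).symm
      · exact (hc n (by omega)).symm

end

end ColourSystem

/-! ### Cyclic fans with a vertex not linked to the hub. -/

namespace ColourSystem

variable {V C : Type*}

theorem exists_pow_succ_eq_of_isCycle [Finite C] {π : Equiv.Perm C} (hπ : π.IsCycle) {c d : C}
    (hc : π c ≠ c) (hd : π d ≠ d) : ∃ i < orderOf π, (π ^ (i + 1)) c = d := by
  obtain ⟨i, hi⟩ := hπ.exists_pow_eq hc hd
  have hN : 0 < orderOf π := orderOf_pos π
  refine ⟨(i + (orderOf π - 1)) % orderOf π, Nat.mod_lt _ hN, ?_⟩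
  rw [pow_succ, pow_mod_orderOf, ← pow_succ, add_assoc, Nat.sub_add_cancel hN, pow_add,
    pow_orderOf_eq_one, mul_one, hi]

theorem pow_succ_inj_of_isCycle [Finite C] {π : Equiv.Perm C} (hπ : π.IsCycle) {c : C}
    (hc : π c ≠ c) {i j : ℕ} (hi : i < orderOf π) (hj : j < orderOf π)
    (h : (π ^ (i + 1)) c = (π ^ (j + 1)) c) : i = j := by
  have h1 : π ^ (i + 1) = π ^ (j + 1) := hπ.pow_eq_pow_iff.2 ⟨c, hc, h⟩
  rw [pow_succ, pow_succ, mul_left_inj] at h1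
  exact pow_injOn_Iio_orderOf hi hj h1

/-- A cyclic fan can be rotated if one of its vertices `x` is not linked to the hub by the two
colours missing at `x` and at the hub. -/
theorem exists_rotation_of_not_linked [Finite C] [DecidableEq C] {S : ColourSystem V C} {p : V}
    {π : Equiv.Perm C} (hf : S.IsFan p π) (hπ : π.IsCycle) {c : C} (hc : π c ≠ c)
    (hl : ¬ S.Linked (S.miss p) (π c) p (S.nbr c p)) :
    ∃ S', KempeEquiv S S' ∧ Rotation S S' p π := by
  obtain ⟨K, hK, hxK, hpK⟩ := exists_closed_of_not_linked fun h => hl (Linked.symm h)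
  set z := S.miss p with hz
  set x := S.nbr c p with hx
  set N := orderOf π with hN
  have hNpos : 0 < N := orderOf_pos π
  have hπz : π z = z := hf.apply_miss
  have hmoved : ∀ i, π ((π ^ i) c) ≠ (π ^ i) c := by
    intro i e
    rw [← Equiv.Perm.mul_apply, ← pow_succ', pow_succ, Equiv.Perm.mul_apply] at e
    exact hc ((π ^ i).injective e)
  have hne_z : ∀ i, (π ^ i) c ≠ z := fun i e => hmoved i (by rw [e, hπz])
  -- The cycle is opened at `x`: the fan runs from the spoke coloured `π c` to that of `x`, coloured
  -- `c`, and ends in `z`, which `x` misses after the exchange on `K`.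
  obtain ⟨y, hy⟩ : ∃ y : ℕ → C, ∀ i, y i = if i < N then (π ^ (i + 1)) c else z := ⟨_, fun _ => rfl⟩
  have hylt : ∀ {i}, i < N → y i = (π ^ (i + 1)) c := fun h => (hy _).trans (if_pos h)
  have hyN : y N = z := (hy N).trans (if_neg (lt_irrefl N))
  have hy0 : y 0 = π c := by rw [hylt hNpos, zero_add, pow_one]
  have hylast : ∀ {i}, i + 1 = N → y i = c := by
    intro i hi
    rw [hylt (by omega), hi, hN, pow_orderOf_eq_one, Equiv.Perm.one_apply]
  have hπy : ∀ {i}, i + 1 < N → π (y i) = y (i + 1) := by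
    intro i hi
    rw [hylt hi, hylt (by omega), ← Equiv.Perm.mul_apply, ← pow_succ']
  have hinj : ∀ i ≤ N, ∀ j ≤ N, y i = y j → i = j := by
    intro i hi j hj e
    rcases hi.lt_or_eq with hi | rfl <;> rcases hj.lt_or_eq with hj | rfl
    · rw [hylt hi, hylt hj] at e
      exact pow_succ_inj_of_isCycle hπ hc hi hj e
    · rw [hylt hi, hyN] at e
      exact absurd e (hne_z _)
    · rw [hylt hj, hyN] at e
      exact absurd e.symm (hne_z _)
    · rfl
  obtain ⟨S2, π2, hS2, hr2, hπ2, hlast, hfix⟩ :=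
    exists_rotation_path (p := p) N (S.kempe z (π c) K hK) y (by
      intro i hi
      rw [kempe_nbr_not_mem hK hpK]
      have hm : S.miss (S.nbr (y i) p) = π (y i) := (hf _ (by rw [hylt hi]; exact hmoved _)).symm
      rcases Nat.lt_or_ge (i + 1) N with h1 | h1
      · rw [hπy h1] at hm
        rw [kempe_miss_of_ne hK, hm]
        · rw [hm, hylt h1]
          exact hne_z _
        · rw [hm, ← hy0]
          intro e
          have := hinj _ h1.le _ hNpos.le e
          omega
      · have h2 : i + 1 = N := by omega
        rw [hylast h2] at hm ⊢
        rw [kempe_miss_mem hK hxK, h2, hyN, hm, Equiv.swap_apply_right])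
      (by rw [kempe_miss_not_mem hK hpK, hyN]) hinj
  have h1p : ∀ d, (S.kempe z (π c) K hK).nbr d p = S.nbr d p := kempe_nbr_not_mem hK hpK
  have hxp : x ≠ p := fun e => hpK (e ▸ hxK)
  have hzx : S2.nbr z p = x := by
    have := hr2.hub c
    rw [h1p] at this
    have h1 : N - 1 + 1 = N := by omega
    have h2 := hπ2 (N - 1) (by omega)
    rw [hylast h1, h1, hyN] at h2
    rwa [h2] at this
  have hpp : S2.nbr (π c) p = p := by
    rw [S2.nbr_eq_self_iff, hr2.miss_hub, kempe_miss_not_mem hK hpK, ← hz, ← hyN, hlast, hy0]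
  -- The shift gives the edge from `p` to `x` the colour `z` and frees `π c` at `p`, so `p` joins
  -- the exchanged set. A second exchange restores the edges inside `K` and gives that spoke the
  -- colour `π c`.
  have hK2 : S2.Closed z (π c) (insert p K) := by
    rintro v (rfl | hv)
    · rw [hzx, hpp]
      exact ⟨Or.inr hxK, Or.inl rfl⟩
    · have hvp : v ≠ p := fun e => hpK (e ▸ hv)
      have hgen : ∀ d, d = z ∨ d = π c → S2.nbr d v ∈ insert p K := by
        intro d hd
        by_cases h1 : S2.nbr d v = p
        · exact Or.inl h1
        by_cases h2 : v = S2.nbr d v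
        · rw [← h2]
          exact Or.inr hv
        refine Or.inr ?_
        rw [← (hr2.away d v _ hvp h1 h2).2 rfl, kempe_nbr_mem hK hv]
        refine hK.nbr_swap_mem hv ?_
        rcases hd with rfl | rfl <;> simp
      exact ⟨hgen _ (Or.inl rfl), hgen _ (Or.inr rfl)⟩
  have hswap : ∀ d, Equiv.swap z (π c) (π d) = π2 d := by
    intro d
    by_cases hd : π d = d
    · by_cases hdz : d = z
      · rw [hdz, hπz, Equiv.swap_apply_left, ← hyN, hlast, hy0]
      · rw [hd, Equiv.swap_apply_of_ne_of_ne hdz, hfix]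
        · intro i hi e
          rcases hi.lt_or_eq with hi | rfl
          · rw [hylt hi] at e
            exact hmoved (i + 1) (by rw [e, hd])
          · exact hdz (e.symm.trans hyN)
        · rintro rfl
          exact hc (π.injective hd)
    · obtain ⟨i, hi, hid⟩ := exists_pow_succ_eq_of_isCycle hπ hc hd
      rw [← hylt hi] at hid
      rw [← hid, hπ2 i hi]
      rcases Nat.lt_or_ge (i + 1) N with h1 | h1
      · rw [hπy h1, ← hy0, ← hyN]
        exact Equiv.swap_apply_of_ne_of_ne
          (fun e => by have := hinj _ h1.le _ le_rfl e; omega)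
          (fun e => by have := hinj _ h1.le _ hNpos.le e; omega)
      · have h2 : i + 1 = N := by omega
        rw [hylast h2, Equiv.swap_apply_right, h2, hyN]
  refine ⟨_, (kempeEquiv_kempe hK).trans (hS2.trans (kempeEquiv_kempe hK2)), fun d => ?_,
    fun d v w hv hw hvw => ?_⟩
  · rw [kempe_nbr_mem hK2 (Or.inl rfl), hswap, hr2.hub, h1p]
  · by_cases hvK : v ∈ K
    · rw [kempe_nbr_mem hK2 (Or.inr hvK), ← hr2.away _ _ _ hv hw hvw, kempe_nbr_mem hK hvK,
        Equiv.swap_apply_self]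
    · have hvK2 : v ∉ insert p K := fun h => h.elim hv hvK
      rw [kempe_nbr_not_mem hK2 hvK2, ← hr2.away _ _ _ hv hw hvw, kempe_nbr_not_mem hK hvK]

end ColourSystem

/-! ### Iterating a map on a finite set of colours. -/

section Iteration

variable {C : Type*}

/-- Pigeonhole, stopped at the first possible index. The initial term `y 0` is never tested against
`Z`. -/
theorem exists_first_repeat [Finite C] (y : ℕ → C) (Z : C → Prop) :
    ∃ n, (Z (y (n + 1)) ∨ ∃ i ≤ n, y i = y (n + 1)) ∧
      (∀ i ≤ n, ∀ j ≤ n, y i = y j → i = j) ∧ ∀ i, 1 ≤ i → i ≤ n → ¬ Z (y i) := by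
  classical
  have hex : ∃ n, Z (y (n + 1)) ∨ ∃ i ≤ n, y i = y (n + 1) := by
    obtain ⟨i, j, hij, h⟩ := Finite.exists_ne_map_eq_of_infinite y
    rcases lt_or_gt_of_ne hij with h' | h'
    · exact ⟨j - 1, Or.inr ⟨i, by omega, by rwa [Nat.sub_add_cancel (by omega)]⟩⟩
    · exact ⟨i - 1, Or.inr ⟨j, by omega, by rw [Nat.sub_add_cancel (by omega), h]⟩⟩
  have hmin := fun m (hm : m < Nat.find hex) => Nat.find_min hex hm
  refine ⟨Nat.find hex, Nat.find_spec hex, ?_, ?_⟩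
  · have key : ∀ i j, i < j → j ≤ Nat.find hex → y i ≠ y j := fun i j hij hj e =>
      hmin (j - 1) (by omega) (Or.inr ⟨i, by omega, by rwa [Nat.sub_add_cancel (by omega)]⟩)
    intro i hi j hj e
    by_contra hne
    rcases lt_or_gt_of_ne hne with h' | h'
    · exact key i j h' hj e
    · exact key j i h' hi e.symm
  · intro i h1 hi hZ
    exact hmin (i - 1) (by omega) (Or.inl (by rwa [Nat.sub_add_cancel h1]))

theorem reflTransGen_of_forall_succ {R : C → C → Prop} {u : ℕ → C} {a b : ℕ} (hab : a ≤ b)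
    (h : ∀ t, a ≤ t → t < b → R (u t) (u (t + 1))) : Relation.ReflTransGen R (u a) (u b) := by
  induction b, hab using Nat.le_induction with
  | base => exact Relation.ReflTransGen.refl
  | succ b hab ih =>
    exact (ih fun t h1 h2 => h t h1 (by omega)).tail (h b hab (by omega))

/-- Fan cycles are assembled by concatenating segments, for which a transitive closure is handier
than iterates. -/
theorem exists_isPeriodicPt_of_transGen {g : C → C} {P : C → Prop} {z : C}
    (h : Relation.TransGen (fun c d => P c ∧ g c = d) z z) :
    ∃ n, 0 < n ∧ Function.IsPeriodicPt g n z ∧ ∀ i, P (g^[i] z) := by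
  have key : ∀ {a b}, Relation.TransGen (fun c d => P c ∧ g c = d) a b →
      ∃ n, g^[n + 1] a = b ∧ ∀ i ≤ n, P (g^[i] a) := by
    intro a b hab
    induction hab with
    | single hb => exact ⟨0, hb.2, fun i hi => by obtain rfl : i = 0 := by omega
                                                  exact hb.1⟩
    | tail _ hb ih =>
      obtain ⟨n, hn, hP⟩ := ih
      refine ⟨n + 1, by rw [Function.iterate_succ_apply', hn, hb.2], fun i hi => ?_⟩
      rcases Nat.le_succ_iff.1 hi with hi | rfl
      · exact hP i hi
      · rw [hn]
        exact hb.1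
  obtain ⟨n, hn, hP⟩ := key h
  have hper : Function.IsPeriodicPt g (n + 1) z := hn
  refine ⟨n + 1, n.succ_pos, hper, fun i => ?_⟩
  rw [← hper.iterate_mod_apply]
  exact hP _ (Nat.lt_succ_iff.1 (Nat.mod_lt _ n.succ_pos))

/-- Follow `g` on the periodic orbit and fix all other points. For the fan map this produces a
cyclic fan. -/
theorem exists_isCycle_of_isPeriodicPt [Finite C] {g : C → C} {n : ℕ} {z : C} (hn : 0 < n)
    (h : Function.IsPeriodicPt g n z) (hz : g z ≠ z) :
    ∃ ρ : Equiv.Perm C, ρ.IsCycle ∧ ρ z = g z ∧ ∀ c, ρ c ≠ c → ρ c = g c ∧ ∃ i, g^[i] z = c := by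
  classical
  let f : C → C := fun c => if ∃ i, g^[i] z = c then g c else c
  have fin : ∀ i, f (g^[i] z) = g^[i + 1] z := fun i => by
    rw [Function.iterate_succ_apply']
    exact if_pos ⟨i, rfl⟩
  have fout : ∀ {c}, (¬ ∃ i, g^[i] z = c) → f c = c := fun h => if_neg h
  have hinj : Function.Injective f := by
    intro c d hcd
    by_cases hc : ∃ i, g^[i] z = c <;> by_cases hd : ∃ i, g^[i] z = d
    · obtain ⟨i, rfl⟩ := hc
      obtain ⟨j, rfl⟩ := hd
      rw [fin, fin] at hcd
      have e : ∀ i, g^[i] z = g^[n - 1] (g^[i + 1] z) := fun i => by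
        rw [← Function.iterate_add_apply, show n - 1 + (i + 1) = i + n by omega,
          Function.iterate_add_apply, h.eq]
      rw [e i, e j, hcd]
    · obtain ⟨i, rfl⟩ := hc
      rw [fin, fout hd] at hcd
      exact absurd ⟨_, hcd⟩ hd
    · obtain ⟨i, rfl⟩ := hd
      rw [fin, fout hc] at hcd
      exact absurd ⟨_, hcd.symm⟩ hc
    · rwa [fout hc, fout hd] at hcd
  let ρ : Equiv.Perm C := Equiv.ofBijective f (Finite.injective_iff_bijective.1 hinj)
  have hρ : ∀ c, ρ c = f c := fun _ => rfl
  have hρz : ρ z = g z := by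
    rw [hρ]
    exact fin 0
  have hmem : ∀ {c}, ρ c ≠ c → ∃ i, g^[i] z = c := fun hc => by
    by_contra h'
    exact hc (fout h')
  have hpow : ∀ i, (ρ ^ i) z = g^[i] z := by
    intro i
    induction i with
    | zero => rfl
    | succ i ih => rw [pow_succ', Equiv.Perm.mul_apply, ih, hρ, fin]
  refine ⟨ρ, ⟨z, by rwa [hρz], fun c hc => ?_⟩, hρz, fun c hc => ⟨?_, hmem hc⟩⟩
  · obtain ⟨i, rfl⟩ := hmem hc
    exact ⟨i, by rw [zpow_natCast, hpow]⟩
  · exact if_pos (hmem hc)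

end Iteration

/-! ### Saturated fans in triangle-free graphs. -/

namespace ColourSystem

variable {V C : Type*}

/-- The adjacency relation of the graph underlying a colour system. -/
def Adj (S : ColourSystem V C) (u v : V) : Prop := u ≠ v ∧ ∃ c, S.nbr c u = v

/-- The graph underlying a colour system has no triangle. -/
def TriangleFree (S : ColourSystem V C) : Prop :=
  ∀ u v w, S.Adj u v → S.Adj v w → ¬ S.Adj u w

theorem Adj.symm {S : ColourSystem V C} {u v : V} (h : S.Adj u v) : S.Adj v u :=
  ⟨h.1.symm, h.2.imp fun _ => S.nbr_comm.1⟩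

theorem adj_nbr {S : ColourSystem V C} {c : C} {v : V} (h : S.nbr c v ≠ v) :
    S.Adj v (S.nbr c v) := ⟨h.symm, c, rfl⟩

section

variable [DecidableEq C] {S T : ColourSystem V C}

theorem kempe_adj {a b : C} {K : Set V} (hK : S.Closed a b K) {u v : V} :
    (S.kempe a b K hK).Adj u v ↔ S.Adj u v := by
  refine and_congr_right fun _ => ?_
  by_cases hu : u ∈ K
  · simp only [kempe_nbr_mem hK hu]
    exact ((Equiv.swap a b).surjective.exists (p := fun c => S.nbr c u = v)).symm
  · simp only [kempe_nbr_not_mem hK hu]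

theorem KempeEquiv.adj (h : KempeEquiv S T) {u v : V} : T.Adj u v ↔ S.Adj u v := by
  induction h with
  | refl => rfl
  | tail _ hs ih =>
    obtain ⟨a, b, K, hK, rfl⟩ := hs
    rw [kempe_adj, ih]

theorem KempeEquiv.triangleFree (h : KempeEquiv S T) (hS : S.TriangleFree) : T.TriangleFree := by
  intro u v w
  rw [h.adj, h.adj, h.adj]
  exact hS u v w

end

/-- Every vertex of the fan is linked to the hub by the two colours missing there. -/
def Saturated (S : ColourSystem V C) (p : V) (π : Equiv.Perm C) : Prop :=
  ∀ c, π c ≠ c → S.Linked (S.miss p) (π c) p (S.nbr c p)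

theorem Saturated.nbr_not_mem {S : ColourSystem V C} {p : V} {π : Equiv.Perm C} {b : C} {K : Set V}
    (hs : S.Saturated p π)
    (hK : S.Closed (S.miss p) b K) (hp : p ∉ K) {c : C} (hc : π c ≠ c) (hb : π c = b) :
    S.nbr c p ∉ K := by
  subst hb
  exact fun h => hp ((hs c hc).symm K hK h)

section

variable [DecidableEq C] {S T : ColourSystem V C} {p : V} {π : Equiv.Perm C}

/-- Exchanges at components avoiding the hub commute with the rotation of a saturated fan. -/
theorem Rotation.kempe {b : C} {K : Set V} (hr : Rotation S T p π) (hf : S.IsFan p π)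
    (hs : S.Saturated p π) (hK : S.Closed (S.miss p) b K) (hp : p ∉ K) :
    (S.kempe _ b K hK).IsFan p π ∧ ∃ hK' : T.Closed (S.miss p) b K,
      Rotation (S.kempe _ b K hK) (T.kempe _ b K hK') p π := by
  -- No spoke moves to the colour missing at the hub, and a spoke moving to `b` ends at a vertex
  -- linked to the hub, hence outside `K`. So the rotation does not disturb `K`.
  have hK' : T.Closed (S.miss p) b K := by
    intro v hv
    have hvp : v ≠ p := fun e => hp (e ▸ hv)
    have hgen : ∀ d, d = S.miss p ∨ d = b → T.nbr d v ∈ K := by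
      intro d hd
      by_cases h1 : T.nbr d v = p
      · rw [T.nbr_comm, hr.hub_inv] at h1
        by_cases h2 : π (π⁻¹ d) = π⁻¹ d
        · rw [perm_apply_inv] at h2
          rw [← h2, S.nbr_comm] at h1
          exact absurd (h1 ▸ hK.nbr_swap_mem hv hd) hp
        · rcases hd with rfl | rfl
          · rw [Equiv.Perm.inv_eq_iff_eq.2 hf.apply_miss.symm] at h2
            exact absurd hf.apply_miss h2
          · exact absurd (h1 ▸ hv) (hs.nbr_not_mem hK hp h2 (perm_apply_inv _ _))
      by_cases h2 : v = T.nbr d v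
      · rwa [← h2]
      · rw [← (hr.away d v _ hvp h1 h2).2 rfl]
        exact hK.nbr_swap_mem hv hd
    exact ⟨hgen _ (Or.inl rfl), hgen _ (Or.inr rfl)⟩
  refine ⟨fun c hc => ?_, hK', fun c => ?_, fun c v w hv hw hvw => ?_⟩
  · rw [kempe_nbr_not_mem hK hp]
    by_cases hb : π c = b
    · rw [kempe_miss_not_mem hK (hs.nbr_not_mem hK hp hc hb), hf c hc]
    · rw [kempe_miss_of_ne hK, hf c hc]
      · rw [← hf c hc]
        intro e
        exact hc (by rw [e, ← π.injective (e.trans hf.apply_miss.symm)])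
      · rwa [← hf c hc]
  · rw [kempe_nbr_not_mem hK' hp, kempe_nbr_not_mem hK hp, hr.hub]
  · by_cases hvK : v ∈ K
    · rw [kempe_nbr_mem hK' hvK, kempe_nbr_mem hK hvK, hr.away _ _ _ hv hw hvw]
    · rw [kempe_nbr_not_mem hK' hvK, kempe_nbr_not_mem hK hvK, hr.away _ _ _ hv hw hvw]

end

/-- The fan map at `q`: the colour missing at the `c`-neighbour of `q`. -/
def next (S : ColourSystem V C) (q : V) (c : C) : C := S.miss (S.nbr c q)

end ColourSystem

namespace ColourSystem

variable {V C : Type*} [Finite C] [DecidableEq C] {S : ColourSystem V C} {p : V}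
  {π : Equiv.Perm C}

/-- After an exchange at components avoiding the hub of a saturated fan, the colour missing at the
hub lies on a cycle of the fan map at a given vertex of the fan, and the hub does not. -/
theorem exists_kempe_next_isPeriodicPt (htf : S.TriangleFree) (hf : S.IsFan p π)
    (hs : S.Saturated p π) {e : C} (he : π e ≠ e) :
    ∃ (b : C) (K : Set V) (hK : S.Closed (S.miss p) b K), p ∉ K ∧
      ∃ n, 0 < n ∧
        Function.IsPeriodicPt ((S.kempe _ b K hK).next (S.nbr e p)) n (S.miss p) ∧
        ∀ i, ((S.kempe _ b K hK).next (S.nbr e p))^[i] (S.miss p) ≠ e := by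
  suffices ∃ (b : C) (K : Set V) (hK : S.Closed (S.miss p) b K), p ∉ K ∧
      Relation.TransGen (fun c d => c ≠ e ∧ (S.kempe _ b K hK).next (S.nbr e p) c = d)
        (S.miss p) (S.miss p) by
    obtain ⟨b, K, hK, hp, h⟩ := this
    exact ⟨b, K, hK, hp, exists_isPeriodicPt_of_transGen h⟩
  set q := S.nbr e p with hq
  set z := S.miss p with hz
  have hqp : q ≠ p := hf.nbr_ne he
  have hpq : S.nbr e q = p := S.nbr_nbr e p
  have hfq : π e = S.miss q := hf e he
  have hπz : π z = z := hf.apply_miss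
  have hez : z ≠ e := fun h => he (h ▸ hπz)
  have hzf : z ≠ S.miss q := fun h => hez (π.injective ((hπz.trans h).trans hfq.symm))
  obtain ⟨y, hy⟩ : ∃ y : ℕ → C, ∀ i, y i = (S.next q)^[i] z := ⟨_, fun _ => rfl⟩
  have hy0 : y 0 = z := hy 0
  have hysucc : ∀ i, S.miss (S.nbr (y i) q) = y (i + 1) := fun i => by
    rw [hy (i + 1), Function.iterate_succ_apply', ← hy]
    rfl
  -- The fan at `q` is followed from `z` until it meets `e`, the colour missing at `q`, or an
  -- earlier colour. A return to `z` is the desired cycle, and an empty exchange then suffices.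
  obtain ⟨m, hm, hinj, hZ⟩ := exists_first_repeat y (fun c => c = e ∨ c = S.miss q)
  have hye : ∀ i ≤ m, y i ≠ e ∧ y i ≠ S.miss q := by
    intro i hi
    rcases Nat.eq_zero_or_pos i with rfl | h0
    · rw [hy0]
      exact ⟨hez, hzf⟩
    · exact not_or.1 (hZ i h0 hi)
  obtain ⟨x, hx⟩ : ∃ x : ℕ → V, ∀ i, x i = S.nbr (y i) q := ⟨_, fun _ => rfl⟩
  have hmx : ∀ i, S.miss (x i) = y (i + 1) := fun i => by rw [hx, hysucc]
  have hxq : ∀ i ≤ m, x i ≠ q := fun i hi h =>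
    (hye i hi).2 (S.nbr_eq_self_iff.1 ((hx i).symm.trans h))
  have hxp : ∀ i ≤ m, x i ≠ p := fun i hi h =>
    (hye i hi).1 (S.nbr_inj (((hx i).symm.trans h).trans hpq.symm))
  set b := y (m + 1) with hb
  by_cases hbz : b = z
  · have hK : S.Closed z z ∅ := fun v hv => hv.elim
    refine ⟨z, ∅, hK, Set.notMem_empty p, ?_⟩
    have hchain : ∀ t, t ≤ m → y t ≠ e ∧ (S.kempe z z ∅ hK).next q (y t) =
        y (t + 1) := by
      intro t ht
      refine ⟨(hye t ht).1, ?_⟩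
      rw [next, kempe_nbr_not_mem _ (Set.notMem_empty _), kempe_miss_not_mem _ (Set.notMem_empty _),
        hysucc]
    have h1 := reflTransGen_of_forall_succ (R := fun c d => c ≠ e ∧
      (S.kempe z z ∅ hK).next q c = d) (Nat.zero_le m)
      fun t _ ht => hchain t ht.le
    have h2 := Relation.TransGen.tail' h1 (hchain m le_rfl)
    rwa [hy0, ← hb, hbz] at h2
  -- Besides `p`, two vertices miss `b`, and at most one of them is linked to `p`; so some `x j`
  -- missing `b` lies in a closed set avoiding `p`. Only a repeated colour allows `q ∈ K`.
  obtain ⟨K, hK, hpK, hjK, hqK⟩ : ∃ K, S.Closed z b K ∧ p ∉ K ∧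
      (∃ j, j ≤ m ∧ y (j + 1) = b ∧ x j ∈ K) ∧ (q ∈ K → ∃ i, i + 1 ≤ m ∧ y (i + 1) = b ∧
        (x i ∈ K ∨ x m ∈ K)) := by
    have hend : ∀ w, S.miss w = b → w ≠ p → w ≠ x m → S.Linked z b p w →
        ∃ K, S.Closed z b K ∧ p ∉ K ∧ x m ∈ K := by
      intro w hw hwp hwx hl
      have h1 : ¬ S.Linked z b p (x m) :=
        not_linked_of_miss (Or.inl hz.symm) (Or.inr hw) (Or.inr (hmx m)) hwp.symm
          (hxp m le_rfl).symm hwx hl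
      obtain ⟨K, hK, hxK, hpK⟩ := exists_closed_of_not_linked fun h => h1 (Linked.symm h)
      exact ⟨K, hK, hpK, hxK⟩
    rcases hm with (hm | hm) | ⟨i, hi, hm⟩
    · have hmove : π (π⁻¹ e) ≠ π⁻¹ e := by
        rw [perm_apply_inv]
        intro h
        exact he (Equiv.Perm.inv_eq_iff_eq.1 h.symm).symm
      have hw := hf _ hmove
      rw [perm_apply_inv] at hw
      have hwp := hf.nbr_ne hmove
      have hbe : b = e := hm
      -- The fan vertex at `p` missing `e` differs from `x m`, since otherwise `p`, `q`, `x m` would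
      -- form a triangle.
      obtain ⟨K, hK, hpK, hxK⟩ := hend (S.nbr (π⁻¹ e) p) (hw.symm.trans hbe.symm) hwp (by
          intro h
          refine htf p q (x m) (adj_nbr hqp) ?_ ?_
          · rw [hx]
            exact adj_nbr (by rw [← hx]; exact hxq m le_rfl)
          · rw [← h]
            exact adj_nbr hwp) (by
          have := hs _ hmove
          rw [perm_apply_inv] at this
          rwa [hbe])
      refine ⟨K, hK, hpK, ⟨m, le_rfl, rfl, hxK⟩, fun h => absurd ?_ hpK⟩
      have := (hK q h).2
      rwa [hbe, hpq] at this
    · have hbf : b = S.miss q := hm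
      have hl : S.Linked z b p q := by
        rw [hbf, ← hfq]
        exact hs e he
      obtain ⟨K, hK, hpK, hxK⟩ := hend q hbf.symm hqp (hxq m le_rfl).symm hl
      exact ⟨K, hK, hpK, ⟨m, le_rfl, rfl, hxK⟩, fun h => absurd (hl.symm K hK h) hpK⟩
    · obtain ⟨i, rfl⟩ : ∃ i', i = i' + 1 := by
        rcases i with _ | i
        · exact absurd (hm.symm.trans hy0) hbz
        · exact ⟨i, rfl⟩
      by_cases hl : S.Linked z b p (x i)
      · obtain ⟨K, hK, hpK, hxK⟩ := hend (x i) ((hmx i).trans hm) (hxp i (by omega)) (by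
          intro h
          rw [hx, hx] at h
          have := hinj i (by omega) m le_rfl (S.nbr_inj h)
          omega) hl
        exact ⟨K, hK, hpK, ⟨m, le_rfl, rfl, hxK⟩, fun _ => ⟨i, hi, hm, Or.inr hxK⟩⟩
      · obtain ⟨K, hK, hxK, hpK⟩ := exists_closed_of_not_linked fun h => hl (Linked.symm h)
        exact ⟨K, hK, hpK, ⟨i, by omega, hm, hxK⟩, fun _ => ⟨i, hi, hm, Or.inl hxK⟩⟩
  refine ⟨b, K, hK, hpK, ?_⟩
  set S' := S.kempe z b K hK with hS'
  have hm1 : ∀ {t}, x t ∈ K → y (t + 1) = b → S'.miss (x t) = z := fun h h' => by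
    rw [hS', kempe_miss_mem hK h, hmx, h', Equiv.swap_apply_right]
  have hm2 : ∀ {t}, x t ∉ K → S'.miss (x t) = y (t + 1) := fun h => by
    rw [hS', kempe_miss_not_mem hK h, hmx]
  have hyz : ∀ {t}, t + 1 ≤ m → y (t + 1) ≠ z := fun ht h => by
    have := hinj _ ht 0 (Nat.zero_le m) (h.trans hy0.symm)
    omega
  have hm3 : ∀ {t}, t ≤ m → y (t + 1) ≠ b → S'.miss (x t) = y (t + 1) := fun {t} ht h => by
    have htm : t ≠ m := fun h' => h (by rw [h'])
    rw [hS', kempe_miss_of_ne hK, hmx]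
    · rw [hmx]
      exact hyz (by omega)
    · rwa [hmx]
  -- If `q` lies in `K`, the colours `z` and `b` trade places at `q`: the walk from `z` starts at `x
  -- (i + 1)`, runs to `x m`, and closes there or continues from `x 0` to `x i`.
  by_cases hq' : q ∈ K
  · obtain ⟨i, hi, hib, hxK⟩ := hqK hq'
    have hbe : b ≠ e := fun h => (hye (i + 1) hi).1 (hib.trans h)
    have hsw : ∀ t, S'.nbr (Equiv.swap z b (y t)) q = x t := fun t => by
      rw [hS', kempe_nbr_mem hK hq', Equiv.swap_apply_self, hx]
    have hne : ∀ t ≤ m, Equiv.swap z b (y t) ≠ e := by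
      intro t ht
      by_cases h1 : y t = z
      · rwa [h1, Equiv.swap_apply_left]
      by_cases h2 : y t = b
      · rwa [h2, Equiv.swap_apply_right]
      rw [Equiv.swap_apply_of_ne_of_ne h1 h2]
      exact (hye t ht).1
    have hstep : ∀ t, t < m → t ≠ i → Equiv.swap z b (y t) ≠ e ∧
        S'.next q (Equiv.swap z b (y t)) = Equiv.swap z b (y (t + 1)) := by
      intro t ht hti
      have hb' : y (t + 1) ≠ b := fun h => hti (by
        have := hinj _ (show t + 1 ≤ m by omega) _ hi (h.trans hib.symm)
        omega)
      refine ⟨hne t ht.le, ?_⟩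
      rw [next, hsw, hm3 ht.le hb', Equiv.swap_apply_of_ne_of_ne (hyz (by omega)) hb']
    have c1 := reflTransGen_of_forall_succ (u := fun t => Equiv.swap z b (y t))
      (R := fun c d => c ≠ e ∧ S'.next q c = d) hi
      fun t h1 h2 => hstep t h2 (by omega)
    have c2 := reflTransGen_of_forall_succ (u := fun t => Equiv.swap z b (y t))
      (R := fun c d => c ≠ e ∧ S'.next q c = d) (Nat.zero_le i)
      fun t _ h2 => hstep t (by omega) (by omega)
    simp only [hib, hy0, Equiv.swap_apply_left, Equiv.swap_apply_right] at c1 c2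
    by_cases hxm : x m ∈ K
    · refine Relation.TransGen.tail' c1 ⟨hne m le_rfl, ?_⟩
      rw [next, hsw, hm1 hxm rfl]
    · refine Relation.TransGen.tail' ((c1.tail (b := Equiv.swap z b (y m)) ⟨hne m le_rfl, ?_⟩).trans
        c2) ⟨hne i (by omega), ?_⟩
      · rw [next, hsw, hm2 hxm]
      · rw [next, hsw, hm1 (hxK.resolve_right hxm) hib]
  -- The spokes at `q` are unchanged, and the first `x j` in `K` missing `b` now misses `z`, closing
  -- the walk.
  · classical
    obtain ⟨hj1, hj2, hj3⟩ := Nat.find_spec hjK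
    have hjmin := fun t (ht : t < Nat.find hjK) => Nat.find_min hjK ht
    set j := Nat.find hjK with hj
    have hnb : ∀ t, S'.nbr (y t) q = x t := fun t => by
      rw [hS', kempe_nbr_not_mem hK hq', hx]
    have c1 := reflTransGen_of_forall_succ (u := y)
      (R := fun c d => c ≠ e ∧ S'.next q c = d) (Nat.zero_le j) fun t _ ht => by
        refine ⟨(hye t (by omega)).1, ?_⟩
        rw [next, hnb]
        by_cases h : y (t + 1) = b
        · exact hm2 fun h' => hjmin t ht ⟨by omega, h, h'⟩
        · exact hm3 (by omega) h
    rw [hy0] at c1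
    refine Relation.TransGen.tail' c1 ⟨(hye j hj1).1, ?_⟩
    rw [next, hnb, hm1 hj3 hj2]

end ColourSystem

/-! ### Commuting rotations at the two ends of an edge. -/

namespace ColourSystem

variable {V C : Type*} {S S' T T' : ColourSystem V C} {p q : V} {π ρ : Equiv.Perm C} {e : C}

theorem Rotation.nbr_of_apply_eq (h : Rotation S S' q ρ) (hqp : q ≠ p) (he : S.nbr e p = q)
    (hρ : ρ e = e) (c : C) : S'.nbr c p = S.nbr c p := by
  have h1 : S'.nbr e p = q := by
    rw [S'.nbr_comm, ← hρ, h.hub, S.nbr_comm, he]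
  by_cases hc : c = e
  · rw [hc, h1, he]
  · exact h.nbr_eq hqp.symm (fun h2 => hc (S.nbr_inj (h2.trans he.symm)))
      fun h2 => hc (S'.nbr_inj (h2.trans h1.symm))

theorem Rotation.miss_of_not_adj (h : Rotation S S' q ρ) {v : V} (hv : v ≠ q)
    (hadj : ¬ S.Adj q v) : S'.miss v = S.miss v :=
  h.miss_eq hv fun c hc => absurd ⟨hv.symm, c, hc⟩ hadj

/-- The rotation about q keeps the missing colour of q and can alter others only at neighbours of q,
none of which is adjacent to p. -/
theorem IsFan.rotation_nbr (hf : S.IsFan p π) (htf : S.TriangleFree) (hρ : S.IsFan q ρ)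
    (h : Rotation S S' q ρ) (hqp : q ≠ p) (he : S.nbr e p = q) (hρe : ρ e = e) :
    S'.IsFan p π := by
  intro c hc
  rw [h.nbr_of_apply_eq hqp he hρe, hf c hc]
  have hcp := hf.nbr_ne hc
  by_cases hcq : S.nbr c p = q
  · rw [hcq, h.miss_hub, hρ.apply_miss]
  · rw [h.miss_of_not_adj hcq]
    exact fun hadj => htf p q (S.nbr c p) ⟨hqp.symm, e, he⟩ hadj (adj_nbr hcp)

/-- Rotations at the two ends of an edge commute, if one of them fixes the colour of that edge and
the other one fixes the colours that the first one moves. -/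
theorem Rotation.comm {T'' : ColourSystem V C} (hqp : q ≠ p) (he : S.nbr e p = q) (hρe : ρ e = e)
    (hρf : ρ (π e) = π e) (h1 : Rotation S S' q ρ) (h2 : Rotation S' T p π)
    (h3 : Rotation S T' p π) (h4 : Rotation T' T'' q ρ) : T = T'' := by
  have hp : ∀ c, T.nbr c p = T''.nbr c p := by
    intro c
    have e1 : T'.nbr (π e) p = q := by rw [h3.hub, he]
    rw [h4.nbr_of_apply_eq hqp e1 hρf, h2.hub_inv, h3.hub_inv, h1.nbr_of_apply_eq hqp he hρe]
  have hq : ∀ c w, w ≠ p → q ≠ w → (T.nbr c q = w ↔ T''.nbr c q = w) := by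
    intro c w hwp hqw
    rw [← h2.away c q w hqp hwp hqw, h1.hub_inv, h4.hub_inv, h3.away _ q w hqp hwp hqw]
  refine ext_edges fun c v w hvw => ?_
  by_cases hv : v = p
  · rw [hv, hp]
  by_cases hw : w = p
  · rw [T.nbr_comm, T''.nbr_comm, hw, hp]
  by_cases hvq : v = q
  · rw [hvq]
    exact hq c w hw (hvq ▸ hvw)
  by_cases hwq : w = q
  · rw [T.nbr_comm, T''.nbr_comm, hwq]
    exact hq c v hv fun h => hvq h.symm
  rw [← h2.away c v w hv hw hvw, ← h1.away c v w hvq hwq hvw, h3.away c v w hv hw hvw,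
    h4.away c v w hvq hwq hvw]

variable [Finite C] [DecidableEq C]

theorem kempeEquiv_of_rotation_of_not_saturated (hf : S.IsFan p π) (hπ : π.IsCycle)
    (hr : Rotation S T p π) (hs : ¬ S.Saturated p π) : KempeEquiv S T := by
  simp only [Saturated, not_forall] at hs
  obtain ⟨c, hc, hl⟩ := hs
  obtain ⟨T', hT', hr'⟩ := exists_rotation_of_not_linked hf hπ hc hl
  rwa [hr.unique hr']

/-- The periodic orbit is a second cyclic fan `ρ`, around a neighbour q of p. When both `S` and `T`
are saturated, the route is to rotate `ρ`, then `π`, then undo `ρ`. -/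
theorem kempeEquiv_of_rotation_of_next (htf : S.TriangleFree) (hf : S.IsFan p π)
    (hπ : π.IsCycle) (hr : Rotation S T p π) (he : π e ≠ e) {n : ℕ} (hn : 0 < n)
    (hper : Function.IsPeriodicPt (S.next (S.nbr e p)) n (S.miss p))
    (hne : ∀ i, (S.next (S.nbr e p))^[i] (S.miss p) ≠ e) : KempeEquiv S T := by
  by_cases hs : S.Saturated p π
  swap
  · exact kempeEquiv_of_rotation_of_not_saturated hf hπ hr hs
  have hf' := hf.rotation hr
  by_cases hs' : T.Saturated p π⁻¹
  swap
  · exact (kempeEquiv_of_rotation_of_not_saturated hf' hπ.inv hr.symm hs').symm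
  obtain ⟨q, hq⟩ : ∃ q, S.nbr e p = q := ⟨_, rfl⟩
  obtain ⟨z, hz⟩ : ∃ z, S.miss p = z := ⟨_, rfl⟩
  rw [hq, hz] at hper hne
  have hqp : q ≠ p := hq ▸ hf.nbr_ne he
  have hfq : π e = S.miss q := hq ▸ hf e he
  have hπz : π z = z := hz ▸ hf.apply_miss
  have hzf : z ≠ S.miss q := fun h => he (by
    have : z = e := π.injective ((hπz.trans h).trans hfq.symm)
    rw [← this, hπz])
  have hlpq : S.Linked z (S.miss q) p q := by
    rw [← hz, ← hfq, ← hq]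
    exact hs e he
  have hgz : S.next q z ≠ z := by
    intro h
    have h1 : S.miss (S.nbr z q) = z := h
    have h2 : S.nbr z q = q := by
      rw [← h1, S.nbr_comm, h1]
      have := S.nbr_miss (S.nbr z q)
      rw [h1, S.nbr_nbr] at this
      exact this.symm
    rw [h2] at h1
    exact hzf h1.symm
  obtain ⟨ρ, hρc, hρz, hρ⟩ := exists_isCycle_of_isPeriodicPt hn hper hgz
  have hfρ : S.IsFan q ρ := fun c hc => (hρ c hc).1
  have hρe : ρ e = e := by
    by_contra h
    obtain ⟨i, hi⟩ := (hρ e h).2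
    exact hne i hi
  have hρf : ρ (S.miss q) = S.miss q := hfρ.apply_miss
  have hρzne : ρ z ≠ z := by rwa [hρz]
  have hd : ρ (ρ⁻¹ z) ≠ ρ⁻¹ z := by
    rw [perm_apply_inv]
    exact fun h => hρzne (Equiv.Perm.inv_eq_iff_eq.1 h.symm).symm
  set x := S.nbr (ρ⁻¹ z) q with hx
  have hmx : S.miss x = z := by rw [hx, ← hfρ _ hd, perm_apply_inv]
  have hxq : x ≠ q := hfρ.nbr_ne hd
  have hnbr_ne : ∀ {c}, ρ c ≠ c → S.nbr c q ≠ p := fun hc h => by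
    rw [S.nbr_comm, ← hq] at h
    exact hc (by rw [S.nbr_inj h, hρe])
  have hxp : x ≠ p := hnbr_ne hd
  -- Saturation links `p` to `q`; with `x` also linked, one chain would have three ends.
  obtain ⟨S1, hS1, hr1⟩ := exists_rotation_of_not_linked hfρ hρc hd (by
    rw [perm_apply_inv, ← hx]
    exact fun h => not_linked_of_miss (Or.inr rfl) (Or.inl hz) (Or.inl hmx) hqp hxq.symm
      hxp.symm hlpq.symm h.swap)
  have hnbr1 := hr1.nbr_of_apply_eq hqp hq hρe
  have hm1q : S1.miss q = S.miss q := by rw [hr1.miss_hub, hρf]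
  have hpx1 : S.nbr z q ≠ p := hnbr_ne hρzne
  have hqx1 : S.nbr z q ≠ q := hfρ.nbr_ne hρzne
  have hm1p : S1.miss p = z := by rw [eq_comm, ← S1.nbr_eq_self_iff, hnbr1, ← hz, S.nbr_miss]
  have hm1x : S1.miss (S.nbr z q) = z := hr1.miss_nbr hqx1 hρzne
  -- In `S1` the old `z`-neighbour of `q` misses `z`. If `p` and `q` were still linked, a closed set
  -- `K` around `p` would exclude that vertex; removing `q` from `K` would give a set closed in `S`
  -- that separates `p` from `q`.
  have hns : ¬ S1.Saturated p π := by
    intro h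
    have hl := h e he
    rw [hnbr1, hq, hfq, hm1p] at hl
    obtain ⟨K, hK, hpK, hxK⟩ := exists_closed_of_not_linked <| not_linked_of_miss
      (Or.inl hm1p) (Or.inr hm1q) (Or.inl hm1x) hqp.symm hpx1.symm hqx1.symm hl
    have hK' : S.Closed z (S.miss q) (K \ {q}) := by
      rintro v ⟨hvK, hvq⟩
      have hgen : ∀ c, c = z ∨ c = S.miss q → S.nbr c v ∈ K \ {q} := by
        intro c hc
        have h1 : S.nbr c v ≠ q := by
          intro h1
          rw [S.nbr_comm] at h1
          rcases hc with rfl | rfl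
          · exact hxK (h1 ▸ hvK)
          · rw [S.nbr_miss] at h1
            exact hvq h1.symm
        refine ⟨?_, h1⟩
        by_cases h2 : v = S.nbr c v
        · rwa [← h2]
        · rw [← (hr1.away c v _ hvq h1 h2).1 rfl]
          exact hK.nbr_swap_mem hvK hc
      exact ⟨hgen _ (Or.inl rfl), hgen _ (Or.inr rfl)⟩
    exact (hlpq _ hK' ⟨hpK, hqp.symm⟩).2 rfl
  have hf1 : S1.IsFan p π := hf.rotation_nbr htf hfρ hr1 hqp hq hρe
  obtain ⟨T1, hr2⟩ := hf1.exists_rotation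
  have hT1 : KempeEquiv S1 T1 := kempeEquiv_of_rotation_of_not_saturated hf1 hπ hr2 hns
  have hpq : S.nbr e q = p := by rw [S.nbr_comm, hq]
  have hTpq : T.nbr (π e) q = p := by rw [T.nbr_comm, hr.hub, hq]
  have hTnbr : ∀ {c}, ρ c ≠ c → T.nbr c q = S.nbr c q := fun hc => by
    refine hr.nbr_eq hqp (hnbr_ne hc) fun h => hc ?_
    rw [T.nbr_inj (h.trans hTpq.symm), hfq, hρf]
  have hTmiss : ∀ {c}, ρ c ≠ c → T.miss (S.nbr c q) = S.miss (S.nbr c q) := fun hc =>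
    hr.miss_of_not_adj (hnbr_ne hc) fun hadj =>
      htf p q _ ⟨hqp.symm, e, hq⟩ (adj_nbr (hfρ.nbr_ne hc)) hadj
  have hfT : T.IsFan q ρ := fun c hc => by rw [hTnbr hc, hTmiss hc, hfρ c hc]
  have hTp : T.miss p = z := by rw [hr.miss_hub, hz, hπz]
  have hTq : T.miss q = e := by
    have := hr.miss_nbr (c := e) (by rwa [hq]) he
    rwa [hq] at this
  obtain ⟨T2, hT2, hr3⟩ := exists_rotation_of_not_linked hfT hρc hd (by
    rw [perm_apply_inv, hTnbr hd, ← hx, hTq]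
    have hl := hs' (π e) (by rw [perm_inv_apply]; exact he.symm)
    rw [perm_inv_apply, hr.hub, hq, hTp] at hl
    have hTx : T.miss x = z := (hTmiss hd).trans hmx
    exact fun h => not_linked_of_miss (Or.inr hTq) (Or.inl hTp) (Or.inl hTx) hqp hxq.symm
      hxp.symm hl.symm h.swap)
  have := Rotation.comm hqp hq hρe (by rw [hfq, hρf]) hr1 hr2 hr hr3
  exact hS1.trans (hT1.trans (this ▸ hT2.symm))

/-- In a triangle-free graph, the rotation of a cyclic fan can be realised by Kempe changes. -/
theorem kempeEquiv_of_rotation (htf : S.TriangleFree) (hf : S.IsFan p π) (hπ : π.IsCycle)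
    (hr : Rotation S T p π) : KempeEquiv S T := by
  by_cases hs : S.Saturated p π
  swap
  · exact kempeEquiv_of_rotation_of_not_saturated hf hπ hr hs
  obtain ⟨e, he, -⟩ := id hπ
  obtain ⟨b, K, hK, hp, n, hn, hper, hne⟩ := exists_kempe_next_isPeriodicPt htf hf hs he
  -- The preparatory exchange commutes with the rotation, so it can be undone on the side of `T`.
  obtain ⟨hf', hK', hr'⟩ := hr.kempe hf hs hK hp
  have hS := kempeEquiv_kempe hK
  refine hS.trans ((kempeEquiv_of_rotation_of_next (hS.triangleFree htf) hf' hπ hr' he hn ?_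
    ?_).trans (kempeEquiv_kempe hK').symm)
  · rwa [kempe_nbr_not_mem hK hp, kempe_miss_not_mem hK hp]
  · rwa [kempe_nbr_not_mem hK hp, kempe_miss_not_mem hK hp]

end ColourSystem

/-! ### Turning a perfect matching into a colour class. -/

namespace ColourSystem

variable {V C : Type*} [DecidableEq C] {S : ColourSystem V C}

/-- Either the colour `s` lies on a cycle of the fan map at `p`, or the edge at `p` coloured `s` can
be given another colour without creating edges coloured `s`. -/
theorem next_isPeriodicPt_or_exists_kempeEquiv [Finite C] {s : C} {p : V} (hsp : s ≠ S.miss p) :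
    (∃ n, 0 < n ∧ Function.IsPeriodicPt (S.next p) n s) ∨
      ∃ S', KempeEquiv S S' ∧ S'.nbr s p = p ∧
        ∀ v w, v ≠ p → w ≠ p → v ≠ w → (S.nbr s v = w ↔ S'.nbr s v = w) := by
  classical
  refine or_iff_not_imp_left.2 fun hper => ?_
  set z := S.miss p with hz
  obtain ⟨y, hy⟩ : ∃ y : ℕ → C, ∀ i, y i = (S.next p)^[i] s := ⟨_, fun _ => rfl⟩
  have hy0 : y 0 = s := hy 0
  have hmx : ∀ i, S.miss (S.nbr (y i) p) = y (i + 1) := fun i => by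
    rw [hy (i + 1), Function.iterate_succ_apply', ← hy]
    rfl
  obtain ⟨m, hm, hinj, hZ⟩ := exists_first_repeat y (fun c => c = z)
  have hyz : ∀ i ≤ m, y i ≠ z := by
    intro i hi
    rcases Nat.eq_zero_or_pos i with rfl | h0
    · rwa [hy0]
    · exact hZ i h0 hi
  have hys : ∀ i, y (i + 1) ≠ s := fun i h =>
    hper ⟨i + 1, i.succ_pos, by rw [Function.IsPeriodicPt, Function.IsFixedPt, ← hy, h]⟩
  -- The fan from `s` does not return to `s`. If it ends in a repeated colour `b`, two of its
  -- vertices miss `b`, and an exchange away from `p` makes one of them miss `z`; colour `s` is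
  -- untouched, as neither `z` nor `b` is `s`.
  obtain ⟨S1, j, hjm, hS1, hs1, hp1, hnb1, hmi1, hmj1⟩ : ∃ S1, ∃ j ≤ m, KempeEquiv S S1 ∧
      (∀ v, S1.nbr s v = S.nbr s v) ∧ S1.miss p = z ∧ (∀ c, S1.nbr c p = S.nbr c p) ∧
      (∀ i < j, S1.miss (S.nbr (y i) p) = y (i + 1)) ∧ S1.miss (S.nbr (y j) p) = z := by
    by_cases hmz : y (m + 1) = z
    · exact ⟨S, m, le_rfl, KempeEquiv.refl S, fun _ => rfl, rfl, fun _ => rfl, fun i _ => hmx i,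
        (hmx m).trans hmz⟩
    obtain ⟨i, hi, hib⟩ : ∃ i, i + 1 ≤ m ∧ y (i + 1) = y (m + 1) := by
      obtain ⟨_ | i, hi, h⟩ := hm.resolve_left hmz
      · exact absurd (h.symm.trans hy0) (hys m)
      · exact ⟨i, hi, h⟩
    set b := y (m + 1) with hb
    have hxp : ∀ i ≤ m, S.nbr (y i) p ≠ p := fun i hi h => hyz i hi (S.nbr_eq_self_iff.1 h)
    obtain ⟨K, hK, hpK, hjK⟩ : ∃ K, S.Closed z b K ∧ p ∉ K ∧
        ∃ j, j ≤ m ∧ y (j + 1) = b ∧ S.nbr (y j) p ∈ K := by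
      by_cases hl : S.Linked z b p (S.nbr (y i) p)
      · have h1 : ¬ S.Linked z b p (S.nbr (y m) p) :=
          not_linked_of_miss (Or.inl hz.symm) (Or.inr ((hmx i).trans hib)) (Or.inr (hmx m))
            (hxp i (by omega)).symm (hxp m le_rfl).symm (fun h => by
              have := hinj i (by omega) m le_rfl (S.nbr_inj h)
              omega) hl
        obtain ⟨K, hK, hxK, hpK⟩ := exists_closed_of_not_linked fun h => h1 (Linked.symm h)
        exact ⟨K, hK, hpK, m, le_rfl, rfl, hxK⟩
      · obtain ⟨K, hK, hxK, hpK⟩ := exists_closed_of_not_linked fun h => hl (Linked.symm h)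
        exact ⟨K, hK, hpK, i, by omega, hib, hxK⟩
    obtain ⟨hj1, hj2, hj3⟩ := Nat.find_spec hjK
    have hjmin := fun t (ht : t < Nat.find hjK) => Nat.find_min hjK ht
    refine ⟨S.kempe z b K hK, Nat.find hjK, hj1, kempeEquiv_kempe hK,
      kempe_nbr_of_ne hK hsp (hys m).symm, kempe_miss_not_mem hK hpK, kempe_nbr_not_mem hK hpK,
      fun t ht => ?_, by rw [kempe_miss_mem hK hj3, hmx, hj2, Equiv.swap_apply_right]⟩
    by_cases h : y (t + 1) = b
    · rw [kempe_miss_not_mem hK fun h' => hjmin t ht ⟨by omega, h, h'⟩, hmx]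
    · rw [kempe_miss_of_ne hK, hmx]
      · rw [hmx]
        exact hyz _ (by omega)
      · rwa [hmx]
  obtain ⟨y', hy'⟩ : ∃ y' : ℕ → C, ∀ i, y' i = if i ≤ j then y i else z := ⟨_, fun _ => rfl⟩
  have hlt : ∀ {i}, i ≤ j → y' i = y i := fun h => (hy' _).trans (if_pos h)
  have hend : y' (j + 1) = z := (hy' _).trans (if_neg (by omega))
  obtain ⟨S2, π, hS2, hr, -, hlast, -⟩ := exists_rotation_path (p := p) (j + 1) S1 y' (by
      intro i hi
      rw [hlt (by omega), hnb1]
      rcases Nat.lt_succ_iff_lt_or_eq.1 hi with hi | rfl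
      · rw [hmi1 i hi, hlt hi]
      · rw [hmj1, hend]) (by rw [hp1, hend]) (by
      intro i hi k hk e
      rcases Nat.le_succ_iff.1 hi with hi | rfl <;> rcases Nat.le_succ_iff.1 hk with hk | rfl
      · rw [hlt hi, hlt hk] at e
        exact hinj i (by omega) k (by omega) e
      · rw [hlt hi, hend] at e
        exact absurd e (hyz i (by omega))
      · rw [hlt hk, hend] at e
        exact absurd e.symm (hyz k (by omega))
      · rfl)
  refine ⟨S2, hS1.trans hS2, ?_, fun v w hv hw hvw => ?_⟩
  · rw [S2.nbr_eq_self_iff, hr.miss_hub, hp1, ← hend, hlast, hlt (Nat.zero_le j), hy0]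
  · rw [← hr.away s v w hv hw hvw, hs1]

section Matching

/-- The vertices whose edge coloured `s` is not in the perfect matching `M`. -/
def ugly (S : ColourSystem V C) (s : C) (M : V → V) : Set V :=
  {v | S.nbr s v ≠ v ∧ S.nbr s v ≠ M v}

/-- The vertices whose edge in the perfect matching `M` is not coloured `s`. -/
def bad (S : ColourSystem V C) (s : C) (M : V → V) : Set V := {v | S.nbr s v ≠ M v}

variable {s : C} {M : V → V}

/-- The edge from u to `M u` is a chain by itself and takes the colour `s`. Only its ends change
their `s`-neighbours, and both become correct. -/
theorem exists_kempeEquiv_of_miss_eq (hM : ∀ v, M (M v) = v) (hadj : ∀ v, S.Adj v (M v)) {u : V}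
    (hu : S.miss u = s) (hMu : S.miss (M u) = s) :
    ∃ S', KempeEquiv S S' ∧ S'.ugly s M ⊆ S.ugly s M ∧ S'.bad s M ⊂ S.bad s M := by
  obtain ⟨hne, c, hc⟩ := hadj u
  obtain ⟨S', hS', hr⟩ := exists_rotation_swap (S := S) (p := u) (b := c) (by rw [hc]; exact hne.symm)
    (by rw [hc, hu, hMu])
  rw [hu] at hr
  have h1 : S'.nbr s u = M u := by
    have := hr.hub c
    rwa [Equiv.swap_apply_right, hc] at this
  have h2 : S'.nbr s (M u) = u := by rw [S'.nbr_comm, h1]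
  have h3 : ∀ v, v ≠ u → v ≠ M u → S'.nbr s v = S.nbr s v := by
    intro v hv hv'
    refine hr.nbr_eq hv (fun h => ?_) fun h => ?_
    · rw [S.nbr_comm, ← hu, S.nbr_miss] at h
      exact hv h.symm
    · rw [S'.nbr_comm, h1] at h
      exact hv' h.symm
  have hSu : S.nbr s u = u := by rw [← hu, S.nbr_miss]
  refine ⟨S', hS', fun v hv => ?_, fun v hv => ?_, fun h => ?_⟩
  · by_cases e1 : v = u
    · exact absurd (by rw [e1, h1]) hv.2
    by_cases e2 : v = M u
    · exact absurd (by rw [e2, h2, hM]) hv.2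
    · rw [ugly, Set.mem_ofPred_eq, h3 v e1 e2] at hv
      exact hv
  · by_cases e1 : v = u
    · exact absurd (by rw [e1, h1]) hv
    by_cases e2 : v = M u
    · exact absurd (by rw [e2, h2, hM]) hv
    · rw [bad, Set.mem_ofPred_eq, h3 v e1 e2] at hv
      exact hv
  · have : u ∈ S.bad s M := fun e => hne (hSu.symm.trans e)
    exact h this h1

/-- In the second case the `s`-edge at p, which is not in M, disappears and no `s`-edge appears, so
no vertex becomes ugly or bad. -/
theorem exists_kempeEquiv_of_mem_ugly [Finite V] [Finite C] (hM : ∀ v, M (M v) = v) {p : V}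
    (hp : p ∈ S.ugly s M) :
    (∃ n, 0 < n ∧ Function.IsPeriodicPt (S.next p) n s) ∨
      ∃ S', KempeEquiv S S' ∧
        (S'.ugly s M).ncard + (S'.bad s M).ncard < (S.ugly s M).ncard + (S.bad s M).ncard := by
  refine (next_isPeriodicPt_or_exists_kempeEquiv
    fun h => hp.1 (S.nbr_eq_self_iff.2 h)).imp_right ?_
  rintro ⟨S', hS', hpp, haway⟩
  have hne : ∀ {v}, v ≠ p → S'.nbr s v ≠ p := fun hv h => by
    rw [S'.nbr_comm, hpp] at h
    exact hv h.symm
  refine ⟨S', hS', add_lt_add_of_lt_of_le (Set.ncard_lt_ncard ⟨fun v hv => ?_, fun h => ?_⟩)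
    (Set.ncard_le_ncard fun v hv e => ?_)⟩
  · have hvp : v ≠ p := fun e => hv.1 (by rw [e, hpp])
    have := (haway v _ hvp (hne hvp) hv.1.symm).2 rfl
    rw [ugly, Set.mem_ofPred_eq, this]
    exact hv
  · exact (h hp).1 hpp
  · have hvp : v ≠ p := fun h => hp.2 (h ▸ e)
    have hMp : M v ≠ p := fun h => hp.2 (by rw [← h, hM, S.nbr_comm, e])
    by_cases hvM : v = M v
    · have hv1 : v ≠ S'.nbr s v := fun h => hv (by rw [← h, ← hvM])
      exact hv1 (hvM.trans (e.symm.trans ((haway v _ hvp (hne hvp) hv1).2 rfl)))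
    · exact hv ((haway v _ hvp hMp hvM).1 e)

/-- Suppose u misses `s` but its partner v = `M u` does not. Rotating a cyclic fan around the
`s`-neighbour of v frees `s` at v; triangle-freeness keeps it free at u, so uv can be coloured `s`.
-/
theorem exists_kempeEquiv_ncard_lt [Finite V] [Finite C] (htf : S.TriangleFree)
    (hM : ∀ v, M (M v) = v) (hadj : ∀ v, S.Adj v (M v)) (hbad : (S.bad s M).Nonempty) :
    ∃ S', KempeEquiv S S' ∧
      (S'.ugly s M).ncard + (S'.bad s M).ncard < (S.ugly s M).ncard + (S.bad s M).ncard := by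
  by_cases hpair : ∃ u, S.miss u = s ∧ S.miss (M u) = s
  · obtain ⟨u, hu, hMu⟩ := hpair
    obtain ⟨S', hS', h1, h2⟩ := exists_kempeEquiv_of_miss_eq hM hadj hu hMu
    exact ⟨S', hS', add_lt_add_of_le_of_lt (Set.ncard_le_ncard h1) (Set.ncard_lt_ncard h2)⟩
  push Not at hpair
  have hfree : ∀ {v}, S.miss v = s ↔ S.nbr s v = v := by
    intro v
    rw [S.nbr_eq_self_iff, eq_comm]
  have hugly : ∀ {u}, S.miss u = s → M u ∈ S.ugly s M := by
    intro u hu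
    refine ⟨fun h => hpair u hu (hfree.2 h), fun h => ?_⟩
    rw [hM, S.nbr_comm, hfree.1 hu] at h
    exact (hadj u).1 h
  obtain ⟨p, hp⟩ : (S.ugly s M).Nonempty := by
    obtain ⟨v, hv⟩ := hbad
    by_cases h : S.nbr s v = v
    · exact ⟨M v, hugly (hfree.2 h)⟩
    · exact ⟨v, h, hv⟩
  rcases exists_kempeEquiv_of_mem_ugly hM hp with ⟨n, hn, hper⟩ | h
  swap
  · exact h
  -- Periodicity at `p` serves only to produce a vertex missing `s`.
  obtain ⟨u, hu⟩ : ∃ u, S.miss u = s := by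
    obtain ⟨n, rfl⟩ := Nat.exists_eq_succ_of_ne_zero hn.ne'
    rw [Function.IsPeriodicPt, Function.IsFixedPt, Function.iterate_succ_apply'] at hper
    exact ⟨_, hper⟩
  obtain ⟨hv1, hv2⟩ := hugly hu
  rw [hM] at hv2
  obtain ⟨v, hv⟩ : ∃ v, v = M u := ⟨_, rfl⟩
  obtain ⟨w, hw⟩ : ∃ w, w = S.nbr s v := ⟨_, rfl⟩
  rw [← hv, ← hw] at hv1 hv2
  have hwv : S.nbr s w = v := by rw [hw, S.nbr_nbr]
  have hMv : M v = u := by rw [hv, hM]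
  have hwu : w ∈ S.ugly s M := by
    refine ⟨fun h => hv1 (h.symm.trans hwv), fun h => hv2 ?_⟩
    rw [← hM w, ← h, hwv, hMv]
  rcases exists_kempeEquiv_of_mem_ugly hM hwu with ⟨n, hn, hper⟩ | h
  swap
  · exact h
  have hnext : S.next w s ≠ s := by
    intro h
    rw [next, hwv, hfree] at h
    exact hv1 (hw.trans h)
  obtain ⟨ρ, hρ, hρs, hρ'⟩ := exists_isCycle_of_isPeriodicPt hn hper hnext
  have hf : S.IsFan w ρ := fun c hc => (hρ' c hc).1
  have hρne : ρ s ≠ s := hρs ▸ hnext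
  obtain ⟨S', hr⟩ := hf.exists_rotation
  have hS' := kempeEquiv_of_rotation htf hf hρ hr
  have hvw : S.Adj v w := ⟨hv1.symm, s, hw.symm⟩
  have hv' : S'.miss v = s := by
    have := hr.miss_nbr (c := s) (by rw [hwv]; exact hv1.symm) hρne
    rwa [hwv] at this
  have hu' : S'.miss u = s := by
    rw [hr.miss_of_not_adj hv2.symm, hu]
    exact htf v w u hvw |>.mt (by
      rw [not_not, ← hMv]
      exact hadj v)
  obtain ⟨S'', hS'', h1, h2⟩ := exists_kempeEquiv_of_miss_eq (S := S') hM
    (fun v => hS'.adj.2 (hadj v)) hu' (by rwa [← hv])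
  have hd : ρ (ρ⁻¹ s) ≠ ρ⁻¹ s := by
    rw [perm_apply_inv]
    exact fun h => hρne (Equiv.Perm.inv_eq_iff_eq.1 h.symm).symm
  obtain ⟨y, hy⟩ : ∃ y, y = S.nbr (ρ⁻¹ s) w := ⟨_, rfl⟩
  have hyfree : S.miss y = s := by rw [hy, ← hf _ hd, perm_apply_inv]
  have hwy : S'.nbr s w = y := by rw [hr.hub_inv, hy]
  have hsame : ∀ x, x ≠ w → x ≠ v → x ≠ y → S'.nbr s x = S.nbr s x := by
    intro x hxw hxv hxy
    refine hr.nbr_eq hxw (fun h => ?_) fun h => ?_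
    · rw [S.nbr_comm, hwv] at h
      exact hxv h.symm
    · rw [S'.nbr_comm, hwy] at h
      exact hxy h.symm
  have hvugly : v ∈ S.ugly s M := by
    refine ⟨fun h => hv1 (hw.trans h), fun h => hv2 ?_⟩
    rw [hw, h, hMv]
  have hb : S'.bad s M ⊆ S.bad s M := by
    intro x hx
    by_cases e1 : x = w
    · exact e1 ▸ hwu.2
    by_cases e2 : x = v
    · exact e2 ▸ hvugly.2
    by_cases e3 : x = y
    · intro h
      rw [e3, hfree.1 hyfree] at h
      exact (hadj y).1 h
    · rw [bad, Set.mem_ofPred_eq, hsame x e1 e2 e3] at hx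
      exact hx
  -- The vertex `y` receiving the new `s`-edge may become ugly, but `v` ceases to be. The sum drops
  -- because the bad set then loses `u` and `v`.
  have hug : S'.ugly s M ⊆ insert y (S.ugly s M \ {v}) := by
    intro x hx
    have hxv : x ≠ v := by
      rintro rfl
      exact hx.1 (by rw [← hv', S'.nbr_miss])
    by_cases e3 : x = y
    · exact Or.inl e3
    refine Or.inr ⟨?_, hxv⟩
    by_cases e1 : x = w
    · exact e1 ▸ hwu
    · rw [ugly, Set.mem_ofPred_eq, hsame x e1 hxv e3] at hx
      exact hx
  have hcard : (S'.ugly s M).ncard ≤ (S.ugly s M).ncard := by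
    refine (Set.ncard_le_ncard hug).trans ((Set.ncard_insert_le _ _).trans ?_)
    exact Set.ncard_sdiff_singleton_add_one hvugly |>.le
  have := Set.ncard_le_ncard h1
  have := Set.ncard_lt_ncard (h2.trans_subset hb)
  exact ⟨S'', hS'.trans hS'', by omega⟩

/-- Every perfect matching of a triangle-free graph can be made a colour class. -/
theorem exists_kempeEquiv_nbr_eq [Finite V] [Finite C] (htf : S.TriangleFree)
    (hM : ∀ v, M (M v) = v) (hadj : ∀ v, S.Adj v (M v)) :
    ∃ S', KempeEquiv S S' ∧ ∀ v, S'.nbr s v = M v := by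
  induction h : (S.ugly s M).ncard + (S.bad s M).ncard using Nat.strong_induction_on
    generalizing S with
  | _ n ih =>
    subst h
    by_cases hbad : (S.bad s M).Nonempty
    · obtain ⟨S1, hS1, hlt⟩ := exists_kempeEquiv_ncard_lt htf hM hadj hbad
      obtain ⟨S2, hS2, h2⟩ := ih _ hlt (hS1.triangleFree htf) (fun v => hS1.adj.2 (hadj v)) rfl
      exact ⟨S2, hS1.trans hS2, h2⟩
    · refine ⟨S, KempeEquiv.refl S, fun v => ?_⟩
      by_contra h
      exact hbad ⟨v, h⟩

end Matching

section Restrict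

/-- Forget a colour that is missing nowhere. -/
def restrict (S : ColourSystem V C) (s : C) (h : ∀ v, S.miss v ≠ s) :
    ColourSystem V {c : C // c ≠ s} where
  nbr c := S.nbr c
  miss v := ⟨S.miss v, h v⟩
  nbr_nbr c := S.nbr_nbr c
  nbr_inj h := Subtype.ext (S.nbr_inj h)
  nbr_miss := S.nbr_miss

/-- Exchanges of colours other than `s` do not see the class of `s`, so they lift unchanged. -/
theorem exists_kempeEquiv_of_restrict {s : C} (h : ∀ v, S.miss v ≠ s)
    {R : ColourSystem V {c : C // c ≠ s}} (hR : KempeEquiv (S.restrict s h) R) :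
    ∃ S', KempeEquiv S S' ∧ (∀ v, S'.nbr s v = S.nbr s v) ∧ ∀ c v, S'.nbr c.1 v = R.nbr c v := by
  induction hR with
  | refl => exact ⟨S, KempeEquiv.refl S, fun _ => rfl, fun _ _ => rfl⟩
  | tail _ hstep ih =>
    obtain ⟨S', hS', h1, h2⟩ := ih
    obtain ⟨a, b, K, hK, rfl⟩ := hstep
    have hK' : S'.Closed a.1 b.1 K := by
      intro v hv
      rw [h2, h2]
      exact hK v hv
    refine ⟨_, hS'.trans (kempeEquiv_kempe hK'), fun v => ?_, fun c v => ?_⟩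
    · rw [kempe_nbr_of_ne hK' a.2.symm b.2.symm, h1]
    · by_cases hv : v ∈ K
      · rw [kempe_nbr_mem hK' hv, kempe_nbr_mem hK hv, ← h2,
          Subtype.val_injective.map_swap]
      · rw [kempe_nbr_not_mem hK' hv, kempe_nbr_not_mem hK hv, h2]

end Restrict

end ColourSystem

/-- A colouring of a triangle-free graph can be transformed by Kempe changes into any colouring
that does not use one of the colours. -/
theorem ColourSystem.kempeEquiv_of_miss_const {V : Type*} [Finite V] (n : ℕ) :
    ∀ {C : Type*} [Finite C] [DecidableEq C] (_ : Nat.card C = n) (S T : ColourSystem V C) (c₀ : C),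
      S.TriangleFree → (∀ u v, S.Adj u v ↔ T.Adj u v) → (∀ v, T.miss v = c₀) → KempeEquiv S T := by
  induction n with
  | zero =>
    intro C _ _ hn _ _ c₀
    have : Nonempty C := ⟨c₀⟩
    exact absurd hn Nat.card_pos.ne'
  | succ n ih =>
    intro C _ _ hn S T c₀ htf hadj hT
    by_cases hs : ∃ s, s ≠ c₀
    · obtain ⟨s, hs⟩ := hs
      have hTs : ∀ v, T.miss v ≠ s := fun v h => hs (h ▸ hT v)
      have hTn : ∀ v, T.nbr s v ≠ v := fun v h => hTs v (T.nbr_eq_self_iff.1 h).symm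
      -- `T` misses only `c₀`, so its class `s` is a perfect matching. Once it is shared, `s` can be
      -- deleted from both systems.
      obtain ⟨S1, hS1, h1⟩ := exists_kempeEquiv_nbr_eq (s := s) (M := T.nbr s) htf (T.nbr_nbr s)
        fun v => (hadj _ _).2 (adj_nbr (hTn v))
      have hs1 : ∀ v, S1.miss v ≠ s := fun v h => hTn v (by rw [← h1, ← h, S1.nbr_miss])
      have hadj1 : ∀ u v, S1.Adj u v ↔ T.Adj u v := fun u v => hS1.adj.trans (hadj u v)
      have hcard : Nat.card {c : C // c ≠ s} = n := by
        have := Fintype.ofFinite C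
        rw [Nat.card_eq_fintype_card] at hn ⊢
        rw [Fintype.card_subtype_compl, hn, Fintype.card_subtype_eq, Nat.add_sub_cancel]
      have hres : ∀ {R : ColourSystem V C} (hR : ∀ v, R.miss v ≠ s) {u v},
          (R.restrict s hR).Adj u v ↔ R.Adj u v ∧ R.nbr s u ≠ v := by
        intro R hR u v
        refine ⟨fun ⟨huv, c, hc⟩ => ⟨⟨huv, c, hc⟩, fun e => c.2 (R.nbr_inj (Eq.trans hc e.symm))⟩,
          fun ⟨⟨huv, c, hc⟩, hne⟩ => ⟨huv, ⟨c, fun e => hne (e ▸ hc)⟩, hc⟩⟩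
      have key := ih hcard (S1.restrict s hs1) (T.restrict s hTs) ⟨c₀, hs.symm⟩
        (fun u v w h1 h2 h3 => hS1.triangleFree htf u v w ((hres hs1).1 h1).1 ((hres hs1).1 h2).1
          ((hres hs1).1 h3).1)
        (fun u v => by rw [hres, hres, hadj1, h1]) fun v => Subtype.ext (hT v)
      obtain ⟨S2, hS2, h2, h3⟩ := exists_kempeEquiv_of_restrict hs1 key
      have : S2 = T := ext_nbr fun c v => by
        by_cases hc : c = s
        · rw [hc, h2, h1]
        · exact h3 ⟨c, hc⟩ v
      exact hS1.trans (this ▸ hS2)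
    · push Not at hs
      have : S = T := ext_nbr fun c v => by
        rw [S.nbr_eq_self_iff.2 ((hs c).trans (hs _).symm),
          T.nbr_eq_self_iff.2 ((hs c).trans (hs _).symm)]
      exact this ▸ KempeEquiv.refl S

/-! ### From colour systems back to edge-colourings. -/

namespace SimpleGraph.EdgeColouring

variable {V : Type*} {G : SimpleGraph V} {k : ℕ}

theorem colour_swap (α : G.EdgeColouring k) {u v : V} (h : G.Adj u v) :
    α.colour ⟨s(v, u), h.symm⟩ = α.colour ⟨s(u, v), h⟩ := by
  congr 1
  exact Subtype.ext Sym2.eq_swap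

theorem eq_of_colour_eq (α : G.EdgeColouring k) {u v w : V} (hv : G.Adj u v) (hw : G.Adj u w)
    (h : α.colour ⟨s(u, v), hv⟩ = α.colour ⟨s(u, w), hw⟩) : v = w := by
  by_contra hne
  refine α.proper ⟨s(u, v), hv⟩ ⟨s(u, w), hw⟩ (fun e => hne ?_) u (by simp) (by simp) h
  exact Sym2.congr_right.1 (congrArg Subtype.val e)

open Classical in
theorem kempeSwap_colour (α : G.EdgeColouring k) (c d : Fin k)
    (K : (α.bicoloured c d).ConnectedComponent) {u v : V} (h : G.Adj u v) :
    (α.kempeSwap c d K).colour ⟨s(u, v), h⟩ =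
      if u ∈ K.supp then Equiv.swap c d (α.colour ⟨s(u, v), h⟩) else α.colour ⟨s(u, v), h⟩ := by
  change (if ∃ w ∈ s(u, v), w ∈ K.supp then _ else _) = _
  by_cases hu : u ∈ K.supp
  · rw [if_pos hu, if_pos ⟨u, by simp, hu⟩]
  · rw [if_neg hu]
    split_ifs with hw
    · obtain ⟨w, hw, hwK⟩ := hw
      obtain rfl : w = v := (Sym2.mem_iff.1 hw).resolve_left fun e => hu (e ▸ hwK)
      have hc : ¬ (α.colour ⟨s(u, w), h⟩ = c ∨ α.colour ⟨s(u, w), h⟩ = d) := fun hc =>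
        hu ((ConnectedComponent.mem_supp_congr_adj K ⟨h, hc⟩).2 hwK)
      rw [not_or] at hc
      exact Equiv.swap_apply_of_ne_of_ne hc.1 hc.2
    · rfl

-- A `Step` may swap many chains at once, a `KempeChange` only one; the components inside `K` are
-- swapped one by one.
open Classical in
theorem exists_kempeEquivalent_of_closed [Finite V] {a b : Fin k} (hab : a ≠ b) (K : Set V) :
    ∀ α : G.EdgeColouring k, (∀ u ∈ K, ∀ v, (α.bicoloured a b).Adj u v → v ∈ K) →
      ∃ α', KempeEquivalent α α' ∧ ∀ u v (h : G.Adj u v), α'.colour ⟨s(u, v), h⟩ =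
        if u ∈ K then Equiv.swap a b (α.colour ⟨s(u, v), h⟩) else α.colour ⟨s(u, v), h⟩ := by
  induction h : K.ncard using Nat.strong_induction_on generalizing K with
  | _ n ih =>
    subst h
    intro α hK
    rcases K.eq_empty_or_nonempty with rfl | ⟨v, hv⟩
    · exact ⟨α, Relation.ReflTransGen.refl, fun _ _ _ => by simp⟩
    set c := (α.bicoloured a b).connectedComponentMk v with hc
    have hvc : v ∈ c.supp := rfl
    have hsub : c.supp ⊆ K := by
      intro w hw
      have hr : (α.bicoloured a b).Reachable v w :=
        (ConnectedComponent.exact (hw.trans hc)).symm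
      rw [reachable_iff_reflTransGen] at hr
      clear hw
      induction hr with
      | refl => exact hv
      | tail _ hadj ih' => exact hK _ ih' _ hadj
    have hcol := fun u w (h : G.Adj u w) => α.kempeSwap_colour a b c h
    have hadj : ∀ u w, ((α.kempeSwap a b c).bicoloured a b).Adj u w → (α.bicoloured a b).Adj u w := by
      rintro u w ⟨h, hc'⟩
      rw [hcol] at hc'
      refine ⟨h, ?_⟩
      split_ifs at hc'
      · rw [Equiv.swap_apply_eq_iff, Equiv.swap_apply_eq_iff, Equiv.swap_apply_left,
          Equiv.swap_apply_right] at hc'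
        exact hc'.symm
      · exact hc'
    obtain ⟨α', hα', h'⟩ := ih (K \ c.supp).ncard
      (Set.ncard_lt_ncard ⟨Set.sdiff_subset, fun h => (h hv).2 hvc⟩) (K \ c.supp) rfl
      (α.kempeSwap a b c) fun u hu w huw =>
        ⟨hK u hu.1 w (hadj u w huw), fun hw =>
          hu.2 ((ConnectedComponent.mem_supp_congr_adj c (hadj u w huw)).2 hw)⟩
    refine ⟨α', Relation.ReflTransGen.head ⟨a, b, hab, c, rfl⟩ hα', fun u w h => ?_⟩
    rw [h', hcol]
    by_cases hu : u ∈ c.supp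
    · rw [if_pos hu, if_neg fun h => h.2 hu, if_pos (hsub hu)]
    · rw [if_neg hu]
      by_cases huK : u ∈ K
      · rw [if_pos ⟨huK, hu⟩, if_pos huK]
      · rw [if_neg fun h => huK h.1, if_neg huK]

/-- `α` is the colouring induced by `S` on the copy of `G` with second coordinate `o`. -/
def Represents {B : Type*} (o : B) (α : G.EdgeColouring k) (S : ColourSystem (V × B) (Fin k)) :
    Prop :=
  ∀ u v (h : G.Adj u v), S.nbr (α.colour ⟨s(u, v), h⟩) (u, o) = (v, o)

variable {B : Type*} {o : B} {α β : G.EdgeColouring k} {S S' : ColourSystem (V × B) (Fin k)}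

theorem Represents.unique (hα : Represents o α S) (hβ : Represents o β S) : α = β := by
  refine EdgeColouring.ext (funext fun ⟨e, he⟩ => ?_)
  induction e using Sym2.ind with
  | _ u v => exact S.nbr_inj ((hα u v he).trans (hβ u v he).symm)

/-- Edges of G stay within the copy `o`, so the trace there of a closed set is closed for `α`. A
step with equal colours changes nothing. -/
theorem Represents.exists_of_step [Finite V] (hα : Represents o α S) (h : S.Step S') :
    ∃ α', KempeEquivalent α α' ∧ Represents o α' S' := by
  obtain ⟨a, b, K, hK, rfl⟩ := h
  by_cases hab : a = b
  · subst hab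
    refine ⟨α, Relation.ReflTransGen.refl, fun u v h => ?_⟩
    by_cases hu : (u, o) ∈ K
    · rw [ColourSystem.kempe_nbr_mem hK hu, Equiv.swap_self, Equiv.refl_apply, hα u v h]
    · rw [ColourSystem.kempe_nbr_not_mem hK hu, hα u v h]
  obtain ⟨α', hα', h'⟩ := exists_kempeEquivalent_of_closed hab {u | (u, o) ∈ K} α (by
    rintro u hu v ⟨h, hc⟩
    change (v, o) ∈ K
    rw [← hα u v h]
    exact hK.nbr_swap_mem hu hc)
  refine ⟨α', hα', fun u v h => ?_⟩
  rw [h']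
  by_cases hu : (u, o) ∈ K
  · rw [ColourSystem.kempe_nbr_mem hK hu, if_pos (show u ∈ {u | (u, o) ∈ K} from hu),
      Equiv.swap_apply_self, hα u v h]
  · rw [ColourSystem.kempe_nbr_not_mem hK hu, if_neg (show u ∉ {u | (u, o) ∈ K} from hu), hα u v h]

theorem Represents.kempeEquivalent [Finite V] (hα : Represents o α S) (hβ : Represents o β S')
    (h : S.KempeEquiv S') : KempeEquivalent α β := by
  have : ∃ α', KempeEquivalent α α' ∧ Represents o α' S' := by
    clear hβ
    induction h with
    | refl => exact ⟨α, Relation.ReflTransGen.refl, hα⟩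
    | tail _ hs ih =>
      obtain ⟨α1, h1, hr1⟩ := ih
      obtain ⟨α2, h2, hr2⟩ := hr1.exists_of_step hs
      exact ⟨α2, h1.trans h2, hr2⟩
  obtain ⟨α', h1, h2⟩ := this
  exact h2.unique hβ ▸ h1

end SimpleGraph.EdgeColouring

/-! ### Partial hypercubes and the regular triangle-free extension. -/

/-- Flip the `i`-th bit of `x`, or no bit if `i = 0`. -/
def flipBit {n : ℕ} (i : Fin (n + 1)) (x : Fin (n + 1) → Bool) : Fin (n + 1) → Bool :=
  if i = 0 then x else Function.update x i (!x i)

theorem flipBit_zero {n : ℕ} (x : Fin (n + 1) → Bool) : flipBit 0 x = x := if_pos rfl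

theorem flipBit_apply_self {n : ℕ} {i : Fin (n + 1)} (hi : i ≠ 0) (x : Fin (n + 1) → Bool) :
    flipBit i x i = !x i := by
  rw [flipBit, if_neg hi, Function.update_self]

theorem flipBit_apply_of_ne {n : ℕ} {i j : Fin (n + 1)} (h : j ≠ i) (x : Fin (n + 1) → Bool) :
    flipBit i x j = x j := by
  rw [flipBit]
  split_ifs
  · rfl
  · rw [Function.update_of_ne h]

theorem flipBit_flipBit {n : ℕ} (i : Fin (n + 1)) (x : Fin (n + 1) → Bool) :
    flipBit i (flipBit i x) = x := by
  by_cases hi : i = 0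
  · rw [hi, flipBit_zero, flipBit_zero]
  funext j
  by_cases hj : j = i
  · rw [hj, flipBit_apply_self hi, flipBit_apply_self hi, Bool.not_not]
  · rw [flipBit_apply_of_ne hj, flipBit_apply_of_ne hj]

theorem eq_of_flipBit_apply_ne {n : ℕ} {i j : Fin (n + 1)} {x : Fin (n + 1) → Bool}
    (h : flipBit i x j ≠ x j) : i = j := by
  by_contra hne
  exact h (flipBit_apply_of_ne (Ne.symm hne) x)

theorem flipBit_inj {n : ℕ} {i j : Fin (n + 1)} {x : Fin (n + 1) → Bool}
    (h : flipBit i x = flipBit j x) : i = j := by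
  by_cases hi : i = 0
  · by_contra hne
    have hj : j ≠ 0 := fun e => hne (hi.trans e.symm)
    have := congrFun h j
    rw [flipBit_apply_self hj, hi, flipBit_zero] at this
    simp at this
  · refine (eq_of_flipBit_apply_ne (x := x) ?_).symm
    rw [← h, flipBit_apply_self hi]
    simp

/-- Two different flips change two bits, and a single flip changes at most one. -/
theorem flipBit_triangle {n : ℕ} {i j k : Fin (n + 1)} {x : Fin (n + 1) → Bool}
    (h1 : flipBit i x ≠ x) (h2 : flipBit j (flipBit i x) ≠ flipBit i x)
    (h3 : flipBit j (flipBit i x) ≠ x) (h : flipBit k x = flipBit j (flipBit i x)) : False := by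
  have hi : i ≠ 0 := fun e => h1 (by rw [e, flipBit_zero])
  have hj : j ≠ 0 := fun e => h2 (by rw [e, flipBit_zero])
  have hij : i ≠ j := fun e => h3 (by rw [e, flipBit_flipBit])
  have e1 : k = i := eq_of_flipBit_apply_ne (x := x) (by
    rw [h, flipBit_apply_of_ne hij, flipBit_apply_self hi]
    simp)
  have e2 : k = j := eq_of_flipBit_apply_ne (x := x) (by
    rw [h, flipBit_apply_self hj, flipBit_apply_of_ne hij.symm]
    simp)
  exact hij (e1.symm.trans e2)

/-- A set of colours can be enumerated starting with a given element. -/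
theorem exists_enumeration {n : ℕ} (U : Finset (Fin (n + 1))) {c₀ : Fin (n + 1)} (h0 : c₀ ∈ U) :
    ∃ τ : Fin (n + 1) → Fin (n + 1), Set.InjOn τ U ∧ τ c₀ = 0 ∧
      ∀ i, (∃ c ∈ U, τ c = i) ↔ i.val < U.card := by
  have hcard : U.card ≤ n + 1 := by simpa using U.card_le_univ
  have hpos : 0 < U.card := Finset.card_pos.2 ⟨c₀, h0⟩
  let e : U ≃ Fin U.card := U.equivFin.trans (Equiv.swap (U.equivFin ⟨c₀, h0⟩) ⟨0, hpos⟩)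
  let τ : Fin (n + 1) → Fin (n + 1) := fun c =>
    if h : c ∈ U then Fin.castLE hcard (e ⟨c, h⟩) else 0
  have hτ : ∀ c (h : c ∈ U), τ c = Fin.castLE hcard (e ⟨c, h⟩) := fun c h => dif_pos h
  refine ⟨τ, fun c hc d hd hcd => ?_, ?_, fun i => ⟨?_, fun hi => ?_⟩⟩
  · rw [hτ c hc, hτ d hd] at hcd
    have := e.injective (Fin.castLE_injective hcard hcd)
    exact congrArg Subtype.val this
  · rw [hτ c₀ h0]
    simp [e]
  · rintro ⟨c, hc, rfl⟩
    rw [hτ c hc]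
    exact (e ⟨c, hc⟩).2
  · refine ⟨(e.symm ⟨i, hi⟩).1, (e.symm ⟨i, hi⟩).2, ?_⟩
    rw [hτ _ (e.symm ⟨i, hi⟩).2]
    simp

namespace SimpleGraph.EdgeColouring

variable {V : Type*} {G : SimpleGraph V} {n : ℕ}

/-- The vertex `w` is joined to `v` by an edge of colour `c`. -/
def HasColour {k : ℕ} (α : G.EdgeColouring k) (c : Fin k) (v w : V) : Prop :=
  ∃ h : G.Adj v w, α.colour ⟨s(v, w), h⟩ = c

theorem HasColour.symm {k : ℕ} {α : G.EdgeColouring k} {c : Fin k} {v w : V}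
    (h : α.HasColour c v w) : α.HasColour c w v :=
  ⟨h.1.symm, (α.colour_swap h.1).trans h.2⟩

theorem HasColour.right_unique {k : ℕ} {α : G.EdgeColouring k} {c : Fin k} {u v w : V}
    (hv : α.HasColour c u v) (hw : α.HasColour c u w) : v = w :=
  α.eq_of_colour_eq hv.1 hw.1 (hv.2.trans hw.2.symm)

-- The number of unused colours depends only on the degree; hence all colourings extend to the same
-- graph.
open Classical in
theorem card_unused [Finite V] {k : ℕ} (α : G.EdgeColouring k) (v : V) :
    (Finset.univ.filter fun c => ¬ ∃ w, α.HasColour c v w).card + (G.neighborSet v).ncard = k := by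
  have h1 : (G.neighborSet v).ncard = (Finset.univ.filter fun c => ∃ w, α.HasColour c v w).card := by
    rw [← Set.ncard_coe_finset]
    refine Set.ncard_congr (fun w hw => α.colour ⟨s(v, w), hw⟩) (fun w hw => ?_)
      (fun u w hu hw h => α.eq_of_colour_eq hu hw h) fun c hc => ?_
    · simp only [Finset.coe_filter, Finset.mem_univ, true_and]
      exact ⟨w, hw, rfl⟩
    · simp only [Finset.coe_filter, Finset.mem_univ, true_and] at hc
      obtain ⟨w, hw, h⟩ := hc
      exact ⟨w, hw, h⟩
  rw [h1, add_comm, Finset.card_filter_add_card_filter_not]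
  simp

/-- A colouring of `G` that leaves the colour `m v` unused at every vertex `v` extends to a colour
system on copies of `G`, in which corresponding vertices are joined by the edges of partial
hypercubes. -/
theorem exists_represents [Finite V] (α : G.EdgeColouring (n + 1)) (m : V → Fin (n + 1))
    (hm : ∀ v w, ¬ α.HasColour (m v) v w) :
    ∃ S : ColourSystem (V × (Fin (n + 1) → Bool)) (Fin (n + 1)),
      Represents (fun _ => false) α S ∧ (∀ p, S.miss p = m p.1) ∧
      ∀ p q, S.Adj p q ↔ (G.Adj p.1 q.1 ∧ p.2 = q.2) ∨ (p.1 = q.1 ∧ p.2 ≠ q.2 ∧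
        ∃ i : Fin (n + 1), i.val + (G.neighborSet p.1).ncard < n + 1 ∧ flipBit i p.2 = q.2) := by
  classical
  choose τ hτinj hτ0 hτ using fun v =>
    exists_enumeration (Finset.univ.filter fun c => ¬ ∃ w, α.HasColour c v w) (c₀ := m v)
      (by simpa using hm v)
  have hτ' : ∀ v (i : Fin (n + 1)), (∃ c, (¬ ∃ w, α.HasColour c v w) ∧ τ v c = i) ↔
      i.val + (G.neighborSet v).ncard < n + 1 := by
    intro v i
    have := hτ v i
    have h2 := α.card_unused v
    simp only [Finset.mem_filter, Finset.mem_univ, true_and] at this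
    rw [this]
    omega
  -- A colour unused at a vertex acts on the cube above it. The colour `m v` gets the number 0,
  -- whose flip is the identity, and so is the missing one.
  let N : Fin (n + 1) → V × (Fin (n + 1) → Bool) → V × (Fin (n + 1) → Bool) := fun c p =>
    if h : ∃ w, α.HasColour c p.1 w then (h.choose, p.2) else (p.1, flipBit (τ p.1 c) p.2)
  have N1 : ∀ {c v w x}, α.HasColour c v w → N c (v, x) = (w, x) := by
    intro c v w x h
    have hex : ∃ w, α.HasColour c v w := ⟨w, h⟩
    have : N c (v, x) = (hex.choose, x) := dif_pos hex
    rw [this, hex.choose_spec.right_unique h]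
  have N2 : ∀ {c v x}, (¬ ∃ w, α.HasColour c v w) → N c (v, x) = (v, flipBit (τ v c) x) :=
    fun h => dif_neg h
  let S : ColourSystem (V × (Fin (n + 1) → Bool)) (Fin (n + 1)) :=
    { nbr := N
      miss := fun p => m p.1
      nbr_nbr := by
        rintro c ⟨v, x⟩
        by_cases h : ∃ w, α.HasColour c v w
        · obtain ⟨w, hw⟩ := h
          rw [N1 hw, N1 hw.symm]
        · rw [N2 h, N2 h, flipBit_flipBit]
      nbr_inj := by
        rintro ⟨v, x⟩ c d h
        by_cases hc : ∃ w, α.HasColour c v w <;> by_cases hd : ∃ w, α.HasColour d v w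
        · obtain ⟨w, hw⟩ := hc
          obtain ⟨w', hw'⟩ := hd
          rw [N1 hw, N1 hw'] at h
          obtain rfl : w = w' := congrArg Prod.fst h
          exact hw.2.symm.trans hw'.2
        · obtain ⟨w, hw⟩ := hc
          rw [N1 hw, N2 hd] at h
          exact absurd (congrArg Prod.fst h).symm hw.1.ne
        · obtain ⟨w, hw⟩ := hd
          rw [N1 hw, N2 hc] at h
          exact absurd (congrArg Prod.fst h) hw.1.ne
        · rw [N2 hc, N2 hd] at h
          exact hτinj v (by simpa using hc) (by simpa using hd)
            (flipBit_inj (congrArg Prod.snd h))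
      nbr_miss := by
        rintro ⟨v, x⟩
        rw [N2 (by simpa using hm v), hτ0, flipBit_zero] }
  refine ⟨S, fun u v h => N1 ⟨h, rfl⟩, fun _ => rfl, ?_⟩
  rintro ⟨v, x⟩ ⟨w, y⟩
  constructor
  · rintro ⟨hne, c, hc⟩
    change N c (v, x) = (w, y) at hc
    by_cases h : ∃ w, α.HasColour c v w
    · obtain ⟨u, hu⟩ := h
      rw [N1 hu, Prod.mk.injEq] at hc
      exact Or.inl ⟨hc.1 ▸ hu.1, hc.2⟩
    · rw [N2 h, Prod.mk.injEq] at hc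
      refine Or.inr ⟨hc.1, fun e => hne (Prod.ext hc.1 e), τ v c, (hτ' v _).1 ⟨c, h, rfl⟩, hc.2⟩
  · rintro (⟨h, e⟩ | ⟨e, hne, i, hi, hflip⟩)
    · exact ⟨fun e' => h.ne (congrArg Prod.fst e'), α.colour ⟨s(v, w), h⟩,
        (N1 ⟨h, rfl⟩).trans (Prod.ext rfl e)⟩
    · obtain ⟨c, hc, rfl⟩ := (hτ' v i).2 hi
      exact ⟨fun e' => hne (congrArg Prod.snd e'), c, (N2 hc).trans (Prod.ext e hflip)⟩

theorem kempeEquivalent_of_cliqueFree [Finite V] (hG : G.CliqueFree 3) (γ₀ : G.EdgeColouring n)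
    (α β : G.EdgeColouring (n + 1)) : KempeEquivalent α β := by
  classical
  let γ : G.EdgeColouring (n + 1) :=
    ⟨fun e => (γ₀.colour e).castSucc, fun e f hef v he hf h =>
      γ₀.proper e f hef v he hf (Fin.castSucc_injective n h)⟩
  have hγ : ∀ v w, ¬ γ.HasColour (Fin.last n) v w := fun v w ⟨_, h⟩ => Fin.castSucc_ne_last _ h
  -- The last colour, unused by `γ`, shows that degrees are at most `n`.
  have hunused : ∀ (δ : G.EdgeColouring (n + 1)) v, ∃ c, ∀ w, ¬ δ.HasColour c v w := by
    intro δ v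
    have h1 := γ.card_unused v
    have h2 := δ.card_unused v
    have h3 : 0 < (Finset.univ.filter fun c => ¬ ∃ w, γ.HasColour c v w).card :=
      Finset.card_pos.2 ⟨Fin.last n, by simpa using hγ v⟩
    obtain ⟨c, hc⟩ := Finset.card_pos.1 (by omega :
      0 < (Finset.univ.filter fun c => ¬ ∃ w, δ.HasColour c v w).card)
    exact ⟨c, by simpa using hc⟩
  obtain ⟨T, -, hTm, hTadj⟩ := γ.exists_represents (fun _ => Fin.last n) hγ
  -- A triangle mixing edges of `G` with cube edges would both keep and change a coordinate.
  have hT : T.TriangleFree := by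
    rintro ⟨u, x⟩ ⟨v, y⟩ ⟨w, z⟩ h1 h2 h3
    rw [hTadj] at h1 h2 h3
    dsimp only at h1 h2 h3
    rcases h1 with ⟨a1, b1⟩ | ⟨a1, b1, i, -, c1⟩ <;>
      rcases h2 with ⟨a2, b2⟩ | ⟨a2, b2, j, -, c2⟩ <;>
      rcases h3 with ⟨a3, b3⟩ | ⟨a3, b3, k, -, c3⟩
    · exact hG {u, v, w} (is3Clique_triple_iff.2 ⟨a1, a3, a2⟩)
    · exact b3 (b1.trans b2)
    · exact b2 (b1.symm.trans b3)
    · exact a1.ne (a3.trans a2.symm)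
    · exact b1 (b3.trans b2.symm)
    · exact a2.ne (a1.symm.trans a3)
    · exact a3.ne (a1.trans a2)
    · subst c1 c2
      exact flipBit_triangle b1.symm b2.symm b3.symm c3
  have key : ∀ δ : G.EdgeColouring (n + 1), ∃ S, Represents (fun _ => false) δ S ∧
      S.KempeEquiv T := by
    intro δ
    choose m hm using hunused δ
    obtain ⟨S, hS, -, hSadj⟩ := δ.exists_represents m hm
    have hadj : ∀ p q, S.Adj p q ↔ T.Adj p q := fun p q => (hSadj p q).trans (hTadj p q).symm
    refine ⟨S, hS, ColourSystem.kempeEquiv_of_miss_const _ rfl S T (Fin.last n) ?_ hadj hTm⟩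
    intro u v w
    rw [hadj, hadj, hadj]
    exact hT u v w
  obtain ⟨S, hS, hST⟩ := key α
  obtain ⟨S', hS', hST'⟩ := key β
  exact hS.kempeEquivalent hS' (hST.trans hST'.symm)

end SimpleGraph.EdgeColouring

theorem corollary1p6 {V : Type*} [Finite V] (G : SimpleGraph V) (hG : G.CliqueFree 3)
    (α β : G.EdgeColouring (G.chromaticIndex + 1)) :
    SimpleGraph.EdgeColouring.KempeEquivalent α β := by
  obtain ⟨γ⟩ := G.isLeast_chromaticIndex.1
  exact SimpleGraph.EdgeColouring.kempeEquivalent_of_cliqueFree hG γ α β
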